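/- A ternary $[n,k,d]$ code is a $k$-dimensional subspace of $\mathbb F_3^n$ whose minimum nonzero Hamming weight $\mathrm{wt}$ is $d$. Two ternary codes of length $n$ are equivalent if one is obtained from the other by permuting the coordinates and changing the signs of certain coordinates. For a code $C\subseteq\mathbb F_3^{12}$ write its codewords as $c=(x_1,\dots,x_{10},y_1,y_2)=(x,y)$, let $Pun(C)\subseteq\mathbb F_3^{10}$ be the code obtained by deleting the last two coordinates, and consider the conditions, for all $c=(x,y)\in C$: (C1) $\mathrm{wt}(x)\equiv y_1y_2 \pmod 3$; (C2) if $c\neq 0$, then $\mathrm{wt}(x)\ge 3$; (C3) if $\mathrm{wt}(x)=3$, then $(y_1,y_2)\neq(0,0)$. Two codes of length $12$ are SZ-equivalent if one is obtained from the other by a map $$(x_1,\dots,x_{10},y_1,y_2)\mapsto((-1)^{\alpha_1}x_{\sigma(1)},\dots,(-1)^{\alpha_{10}}x_{\sigma(10)},(-1)^{\beta}y_{\tau(1)},(-1)^{\beta}y_{\tau(2)})$$ with $\alpha_1,\dots,\alpha_{10},\beta\in\{0,1\}$, $\sigma\in S_{10}$, $\tau\in S_2$. Let $C_{10,5}$,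 $C_{10,4,60}$, $C_{10,4,132}$ be the codes with generator matrices $(I_5\mid A)$, where the rows of $A$ are, respectively, $12210,\,01221,\,10122,\,21012,\,22101$; $00111,\,01011,\,10101,\,11001,\,12210$; $00111,\,01011,\,10101,\,11001,\,11111$. Let $\mathcal C_{12,1}$, $\mathcal C_{12,2}$, $\mathcal C_{12,3}$ be the codes of length $12$ whose generator matrices are obtained from these three matrices by appending to the five rows, respectively, the pairs $12,\,12,\,12,\,12,\,12$; $11,\,22,\,22,\,11,\,12$; $11,\,22,\,22,\,11,\,00$. Lemma. Up to SZ-equivalence, there are exactly three ternary $[12,5,6]$ codes satisfying (C1)–(C3), namely $\mathcal C_{12,1},\mathcal C_{12,2},\mathcal C_{12,3}$: these are $[12,5,6]$ codes satisfying (C1)–(C3), they are pairwise not SZ-equivalent, and every ternary $[12,5,6]$ code satisfying (C1)–(C3) is SZ-equivalent to one of them. They arise from $C_{10,5}$, which is the unique ternary $[10,5,5]$ code up to equivalence, and from the two inequivalent $[10,5,4]$ codes $C_{10,4,60}$ and $C_{10,4,132}$: we have $Pun(\mathcal C_{12,1})=C_{10,5}$, $Pun(\mathcal C_{12,2})=C_{10,4,60}$,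 $Pun(\mathcal C_{12,3})=C_{10,4,132}$, and a ternary $[12,5,6]$ code $C$ satisfying (C1)–(C3) is SZ-equivalent to $\mathcal C_{12,i}$ if and only if $Pun(C)$ is equivalent to $Pun(\mathcal C_{12,i})$ $(i=1,2,3)$. -/

import Mathlib

/-- The ambient space `𝔽₃ⁿ`. -/
abbrev TernaryWord (n : ℕ) : Type := Fin n → ZMod 3

/-- A ternary linear code of length `n`: a vector subspace of `𝔽₃ⁿ`. -/
abbrev TernaryCode (n : ℕ) : Type := Submodule (ZMod 3) (TernaryWord n)

/-- `C` is a ternary `[n, k, d]` code: it has dimension `k` and minimum (nonzero) weight `d`. -/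
def IsTernaryCode (n k d : ℕ) (C : TernaryCode n) : Prop :=
  Module.finrank (ZMod 3) C = k ∧ IsLeast {w : ℕ | ∃ c ∈ C, c ≠ 0 ∧ hammingNorm c = w} d

/-- The usual equivalence of ternary codes: one is obtained from the other by permuting the
coordinates and changing the signs of certain coordinates. -/
def CodeEquiv {n : ℕ} (C C' : TernaryCode n) : Prop :=
  ∃ (σ : Equiv.Perm (Fin n)) (α : Fin n → Fin 2),
    (C' : Set (TernaryWord n)) =
      (fun (c : TernaryWord n) (i : Fin n) => (-1) ^ (α i : ℕ) * c (σ i)) '' C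

/-- The part `(x₁, …, x₁₀)` of a word `(x₁, …, x₁₀, y₁, y₂)`. -/
def xPart (c : TernaryWord (10 + 2)) : TernaryWord 10 := fun i => c (Fin.castAdd 2 i)

/-- The part `(y₁, y₂)` of a word `(x₁, …, x₁₀, y₁, y₂)`. -/
def yPart (c : TernaryWord (10 + 2)) : TernaryWord 2 := fun j => c (Fin.natAdd 10 j)

/-- The code punctured at the last two coordinates. -/
def puncture (C : TernaryCode (10 + 2)) : TernaryCode 10 :=
  C.map (LinearMap.funLeft (ZMod 3) (ZMod 3) (Fin.castAdd 2 : Fin 10 → Fin (10 + 2)))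

/-- The three conditions on the codewords `(x₁, …, x₁₀, y₁, y₂)` of a code of length `12`:
`wt (x₁, …, x₁₀) ≡ y₁ y₂ (mod 3)`; `wt (x₁, …, x₁₀) ≥ 3` for nonzero codewords; and
`(y₁, y₂) ≠ (0, 0)` if `wt (x₁, …, x₁₀) = 3`. -/
structure SZConditions (C : TernaryCode (10 + 2)) : Prop where
  weight_mod : ∀ c ∈ C, (hammingNorm (xPart c) : ZMod 3) = yPart c 0 * yPart c 1
  three_le : ∀ c ∈ C, c ≠ 0 → 3 ≤ hammingNorm (xPart c)
  yPart_ne : ∀ c ∈ C, hammingNorm (xPart c) = 3 → yPart c ≠ 0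

/-- The map `(x, y) ↦ ((-1)^{α₁} x_{σ(1)}, …, (-1)^{α₁₀} x_{σ(10)}, (-1)^β y_{τ(1)},
(-1)^β y_{τ(2)})`. -/
def szMap (σ : Equiv.Perm (Fin 10)) (α : Fin 10 → Fin 2) (τ : Equiv.Perm (Fin 2)) (β : Fin 2)
    (c : TernaryWord (10 + 2)) : TernaryWord (10 + 2) :=
  Fin.append (fun i => (-1) ^ (α i : ℕ) * xPart c (σ i))
    (fun j => (-1) ^ (β : ℕ) * yPart c (τ j))

/-- SZ-equivalence of codes of length `12`. -/
def SZEquiv (C C' : TernaryCode (10 + 2)) : Prop :=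
  ∃ (σ : Equiv.Perm (Fin 10)) (α : Fin 10 → Fin 2) (τ : Equiv.Perm (Fin 2)) (β : Fin 2),
    (C' : Set (TernaryWord (10 + 2))) = szMap σ α τ β '' C

/-- The code with generator matrix `G`, i.e. the span of the rows of `G`. -/
def codeOf {k n : ℕ} (G : Matrix (Fin k) (Fin n) (ZMod 3)) : TernaryCode n :=
  Submodule.span (ZMod 3) (Set.range G.row)

/-- The juxtaposition `(M | N)` of two matrices with five rows. -/
def juxtapose {m n : ℕ} (M : Matrix (Fin 5) (Fin m) (ZMod 3)) (N : Matrix (Fin 5) (Fin n) (ZMod 3)) :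
    Matrix (Fin 5) (Fin (m + n)) (ZMod 3) :=
  Matrix.of fun i => Fin.append (M i) (N i)

/-- The generator matrix `(I₅ | A)` of the `[10, 5, 5]` code `C_{10,5}`. -/
def gen10 : Matrix (Fin 5) (Fin (5 + 5)) (ZMod 3) :=
  juxtapose 1 !![1, 2, 2, 1, 0; 0, 1, 2, 2, 1; 1, 0, 1, 2, 2; 2, 1, 0, 1, 2; 2, 2, 1, 0, 1]

/-- The generator matrix `(I₅ | A)` of the `[10, 5, 4]` code `C_{10,4,60}`. -/
def gen60 : Matrix (Fin 5) (Fin (5 + 5)) (ZMod 3) :=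
  juxtapose 1 !![0, 0, 1, 1, 1; 0, 1, 0, 1, 1; 1, 0, 1, 0, 1; 1, 1, 0, 0, 1; 1, 2, 2, 1, 0]

/-- The generator matrix `(I₅ | A)` of the `[10, 5, 4]` code `C_{10,4,132}`. -/
def gen132 : Matrix (Fin 5) (Fin (5 + 5)) (ZMod 3) :=
  juxtapose 1 !![0, 0, 1, 1, 1; 0, 1, 0, 1, 1; 1, 0, 1, 0, 1; 1, 1, 0, 0, 1; 1, 1, 1, 1, 1]

/-- The codes `C_{10,5}`, `C_{10,4,60}`, `C_{10,4,132}`. -/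
def code10 : Fin 3 → TernaryCode 10 :=
  ![codeOf gen10, codeOf gen60, codeOf gen132]

/-- The codes of length `12` with generator matrices `(G | aᵀ bᵀ)`, where `G` generates
`C_{10,5}`, `C_{10,4,60}`, `C_{10,4,132}`. -/
def code12 : Fin 3 → TernaryCode (10 + 2) :=
  ![codeOf (juxtapose gen10 !![1, 2; 1, 2; 1, 2; 1, 2; 1, 2]),
    codeOf (juxtapose gen60 !![1, 1; 2, 2; 2, 2; 1, 1; 1, 2]),
    codeOf (juxtapose gen132 !![1, 1; 2, 2; 2, 2; 1, 1; 0, 0])]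

/-! Over `𝔽₃` every nonzero square is 1, so `wt(x) ≡ ∑ xᵢ²` and (C1) says that the quadratic form `∑
xᵢ² - y₁y₂` vanishes on `C`. As `y` has weight at most 2, minimum weight 6 forces `wt(x) ≥ 4` for
nonzero codewords; in particular `c ↦ x` is injective on `C`.

Take a 4-dimensional subcode on which `y₂ = 0`. Its `x`-weights are multiples of 3 between 4 and 10,
so 6 or 9, and such a `[10,4]` code `E` is unique up to equivalence (`codeEquiv_ovoid`). It is
self-orthogonal, and `E^⊥/E` is an anisotropic plane. A further generator `w` of `C`, cleared at the
four information places of `E`, therefore cannot have `y₂ = 0`; scale it to `y₂ = 1`. The form and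
its polarisation (`IsIsotropicCode.sum_mul`) then determine `y₁` on `w` and on the lifts of the
basis of `E`. So `C` is given by the six remaining entries of `w`, and a finite check sends every
choice compatible with `wt(x) ≥ 4` into one of the three codes by an explicit signed permutation
(`IsIsotropicCode.exists_szEquiv_code12`).

Puncturing turns SZ-equivalence into equivalence, and the three punctured codes are told apart by
minimum weight and by the presence of a word of weight 10. Hence the class of `C` can be read off
from `Pun(C)`.

Both uniqueness statements in length 10 (`codeEquiv_ovoid`, `codeEquiv_golay`) follow one pattern.
In a generator matrix `(I | A)` the minimum weight leaves at most one zero in each row of `A` and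
forbids two rows with the same support. The zeros can be moved to the diagonal and the first row and
column scaled to ones, which leaves few enough matrices for an exhaustive search. -/

/-! ### Monomial maps and equivalence of codes -/

/-- The monomial map `c ↦ (s₁ c_{σ(1)}, …, sₙ c_{σ(n)})`. -/
def monomialMap {n : ℕ} (σ : Equiv.Perm (Fin n)) (s : Fin n → ZMod 3) :
    TernaryWord n →ₗ[ZMod 3] TernaryWord n where
  toFun c i := s i * c (σ i)
  map_add' c d := by ext i; simp [mul_add]
  map_smul' a c := by ext i; simp [mul_left_comm]

@[simp] lemma monomialMap_apply {n : ℕ} (σ : Equiv.Perm (Fin n)) (s : Fin n → ZMod 3)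
    (c : TernaryWord n) (i : Fin n) : monomialMap σ s c i = s i * c (σ i) := rfl

lemma exists_sign_eq (s : ZMod 3) (hs : s ≠ 0) : ∃ a : Fin 2, (-1 : ZMod 3) ^ (a : ℕ) = s := by
  revert s; decide

lemma neg_one_pow_ne_zero_three (a : ℕ) : (-1 : ZMod 3) ^ a ≠ 0 :=
  pow_ne_zero _ (by decide)

lemma mul_self_eq_one {s : ZMod 3} (hs : s ≠ 0) : s * s = 1 := by
  revert s; decide

/-- The signs ±1 are exactly the nonzero scalars of `𝔽₃`; this form makes the equivalence an image
under a linear map. -/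
lemma codeEquiv_iff {n : ℕ} {C C' : TernaryCode n} :
    CodeEquiv C C' ↔ ∃ (σ : Equiv.Perm (Fin n)) (s : Fin n → ZMod 3),
      (∀ i, s i ≠ 0) ∧ C.map (monomialMap σ s) = C' := by
  constructor
  · rintro ⟨σ, α, h⟩
    refine ⟨σ, fun i => (-1) ^ (α i : ℕ), fun i => neg_one_pow_ne_zero_three _, ?_⟩
    apply SetLike.coe_injective
    rw [h]; rfl
  · rintro ⟨σ, s, hs, rfl⟩
    choose α hα using fun i => exists_sign_eq (s i) (hs i)
    refine ⟨σ, α, ?_⟩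
    simp only [hα]; rfl

lemma monomialMap_comp {n : ℕ} (σ ρ : Equiv.Perm (Fin n)) (s t : Fin n → ZMod 3) :
    monomialMap σ s ∘ₗ monomialMap ρ t = monomialMap (σ.trans ρ) (fun i => s i * t (σ i)) := by
  ext c i
  simp [mul_assoc]

lemma monomialMap_inv_comp {n : ℕ} (σ : Equiv.Perm (Fin n)) {s : Fin n → ZMod 3}
    (hs : ∀ i, s i ≠ 0) :
    monomialMap σ.symm (fun i => s (σ.symm i)) ∘ₗ monomialMap σ s = LinearMap.id := by
  rw [monomialMap_comp]
  apply LinearMap.ext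
  intro c
  ext i
  simp [mul_self_eq_one (hs _)]

lemma monomialMap_injective {n : ℕ} (σ : Equiv.Perm (Fin n)) {s : Fin n → ZMod 3}
    (hs : ∀ i, s i ≠ 0) : Function.Injective (monomialMap σ s) := by
  intro c d h
  have := congrArg (monomialMap σ.symm (fun i => s (σ.symm i))) h
  rwa [← LinearMap.comp_apply, ← LinearMap.comp_apply, monomialMap_inv_comp σ hs] at this

lemma hammingNorm_monomialMap {n : ℕ} (σ : Equiv.Perm (Fin n)) {s : Fin n → ZMod 3}
    (hs : ∀ i, s i ≠ 0) (c : TernaryWord n) : hammingNorm (monomialMap σ s c) = hammingNorm c := by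
  simp only [hammingNorm, Finset.card_filter]
  rw [← Equiv.sum_comp σ fun i => if c i ≠ 0 then 1 else 0]
  simp [hs]

lemma CodeEquiv.symm {n : ℕ} {C C' : TernaryCode n} (h : CodeEquiv C C') : CodeEquiv C' C := by
  rw [codeEquiv_iff] at h ⊢
  obtain ⟨σ, s, hs, rfl⟩ := h
  refine ⟨σ.symm, fun i => s (σ.symm i), fun i => hs _, ?_⟩
  rw [← Submodule.map_comp, monomialMap_inv_comp σ hs, Submodule.map_id]

lemma CodeEquiv.trans {n : ℕ} {C C' C'' : TernaryCode n} (h : CodeEquiv C C')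
    (h' : CodeEquiv C' C'') : CodeEquiv C C'' := by
  rw [codeEquiv_iff] at h h' ⊢
  obtain ⟨σ, s, hs, rfl⟩ := h
  obtain ⟨ρ, t, ht, rfl⟩ := h'
  exact ⟨_, _, fun i => mul_ne_zero (ht _) (hs _), by
    rw [← Submodule.map_comp, monomialMap_comp]⟩

lemma finrank_map_of_injective {n m : ℕ} {f : TernaryWord n →ₗ[ZMod 3] TernaryWord m}
    (hf : Function.Injective f) (C : TernaryCode n) :
    Module.finrank (ZMod 3) (C.map f) = Module.finrank (ZMod 3) C :=
  (Submodule.equivMapOfInjective f hf C).finrank_eq.symm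

lemma CodeEquiv.exists_weight {n : ℕ} {C C' : TernaryCode n} (h : CodeEquiv C C')
    {c : TernaryWord n}
    (hc : c ∈ C) : ∃ c' ∈ C', hammingNorm c' = hammingNorm c := by
  obtain ⟨σ, s, hs, rfl⟩ := codeEquiv_iff.1 h
  exact ⟨_, Submodule.mem_map_of_mem hc, hammingNorm_monomialMap σ hs c⟩

/-- A property of weights of nonzero words passes to equivalent codes. -/
lemma CodeEquiv.forall_weight {n : ℕ} {C C' : TernaryCode n} (h : CodeEquiv C C') {P : ℕ → Prop}
    (hP : ∀ c ∈ C, c ≠ 0 → P (hammingNorm c)) : ∀ c ∈ C', c ≠ 0 → P (hammingNorm c) := by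
  intro c hc h0
  obtain ⟨d, hd, e⟩ := h.symm.exists_weight hc
  rw [← e]
  refine hP d hd ?_
  rintro rfl
  rw [hammingNorm_zero, eq_comm, hammingNorm_eq_zero] at e
  exact h0 e

/-- Between codes of equal dimension it suffices to map into. -/
lemma codeEquiv_of_le {n : ℕ} {C C' : TernaryCode n} (σ : Equiv.Perm (Fin n)) {s : Fin n → ZMod 3}
    (hs : ∀ i, s i ≠ 0) (hle : ∀ c ∈ C, monomialMap σ s c ∈ C')
    (hr : Module.finrank (ZMod 3) C = Module.finrank (ZMod 3) C') : CodeEquiv C C' := by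
  refine codeEquiv_iff.2 ⟨σ, s, hs, ?_⟩
  refine Submodule.eq_of_le_of_finrank_eq (Submodule.map_le_iff_le_comap.2 hle) ?_
  rw [finrank_map_of_injective (monomialMap_injective σ hs), hr]

/-! ### Systematic generator matrices -/

section Systematic
variable {k n m : ℕ}

lemma mem_codeOf {G : Matrix (Fin k) (Fin n) (ZMod 3)} {x : TernaryWord n} :
    x ∈ codeOf G ↔ ∃ u : Fin k → ZMod 3, ∑ i, u i • G i = x := by
  unfold codeOf
  rw [Submodule.mem_span_range_iff_exists_fun]
  rfl

/-- The positions `p` form an information set: the coefficients of a codeword are its own entries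
there. -/
lemma mem_codeOf_iff {G : Matrix (Fin k) (Fin n) (ZMod 3)} (p : Fin k → Fin n)
    (hp : ∀ i j, G i (p j) = if i = j then 1 else 0) {x : TernaryWord n} :
    x ∈ codeOf G ↔ ∀ j, x j = ∑ i, x (p i) * G i j := by
  rw [mem_codeOf]
  constructor
  · rintro ⟨u, rfl⟩ j
    simp [Finset.sum_apply, hp]
  · intro h
    exact ⟨fun i => x (p i), by ext j; simp [Finset.sum_apply, ← h j]⟩

lemma finrank_codeOf {G : Matrix (Fin k) (Fin n) (ZMod 3)} (p : Fin k → Fin n)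
    (hp : ∀ i j, G i (p j) = if i = j then 1 else 0) :
    Module.finrank (ZMod 3) (codeOf G) = k := by
  unfold codeOf
  rw [finrank_span_eq_card, Fintype.card_fin]
  rw [Fintype.linearIndependent_iff]
  intro g hg i
  have := congrFun hg (p i)
  simpa [Finset.sum_apply, hp, Matrix.row] using this

/-- The matrix `(I | A)`. -/
def sysMatrix (A : Matrix (Fin k) (Fin m) (ZMod 3)) : Matrix (Fin k) (Fin (k + m)) (ZMod 3) :=
  Matrix.of fun i => Fin.append (Pi.single i 1) (A i)

/-- The code with generator matrix `(I | A)`. -/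
def sysCode (A : Matrix (Fin k) (Fin m) (ZMod 3)) : TernaryCode (k + m) := codeOf (sysMatrix A)

lemma sysMatrix_castAdd (A : Matrix (Fin k) (Fin m) (ZMod 3)) (i j : Fin k) :
    sysMatrix A i (Fin.castAdd m j) = if i = j then 1 else 0 := by
  simp [sysMatrix, Pi.single_apply, eq_comm]

lemma sysMatrix_natAdd (A : Matrix (Fin k) (Fin m) (ZMod 3)) (i : Fin k) (j : Fin m) :
    sysMatrix A i (Fin.natAdd k j) = A i j := by
  simp [sysMatrix]

lemma finrank_sysCode (A : Matrix (Fin k) (Fin m) (ZMod 3)) :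
    Module.finrank (ZMod 3) (sysCode A) = k :=
  finrank_codeOf _ (sysMatrix_castAdd A)

lemma mem_sysCode {A : Matrix (Fin k) (Fin m) (ZMod 3)} {x : TernaryWord (k + m)} :
    x ∈ sysCode A ↔ ∀ j, x (Fin.natAdd k j) = ∑ i, x (Fin.castAdd m i) * A i j := by
  unfold sysCode
  rw [mem_codeOf_iff _ (sysMatrix_castAdd A)]
  constructor
  · intro h j
    simpa [sysMatrix_natAdd] using h (Fin.natAdd k j)
  · intro h j
    refine Fin.addCases (fun i => ?_) (fun i => ?_) j
    · simp [sysMatrix_castAdd]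
    · simpa [sysMatrix_natAdd] using h i

lemma append_mem_sysCode (A : Matrix (Fin k) (Fin m) (ZMod 3)) (u : Fin k → ZMod 3) :
    (Fin.append u (fun j => ∑ i, u i * A i j) : TernaryWord (k + m)) ∈ sysCode A := by
  rw [mem_sysCode]; intro j; simp

lemma hammingNorm_append (u : TernaryWord k) (v : TernaryWord m) :
    hammingNorm (Fin.append u v : TernaryWord (k + m)) = hammingNorm u + hammingNorm v := by
  simp only [hammingNorm, Finset.card_filter, Fin.sum_univ_add, Fin.append_left, Fin.append_right]

/-- Every code is equivalent to one with a systematic generator matrix. -/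
lemma exists_codeEquiv_sysCode (C : TernaryCode (k + m)) (hC : Module.finrank (ZMod 3) C = k) :
    ∃ A : Matrix (Fin k) (Fin m) (ZMod 3), CodeEquiv C (sysCode A) := by
  -- The coordinate functionals span the dual of `C`, since a word with all coordinates zero is
  -- zero. A basis chosen among them is an information set, and `σ` brings it to the front.
  let φ : Fin (k + m) → Module.Dual (ZMod 3) C := fun j => LinearMap.proj j ∘ₗ C.subtype
  obtain ⟨κ, a, ha, hsp, hli⟩ := exists_linearIndependent' (ZMod 3) φ
  have hspan : Submodule.span (ZMod 3) (Set.range φ) = ⊤ := by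
    rw [eq_top_iff]
    intro f _
    refine mem_span_of_iInf_ker_le_ker fun x hx => ?_
    have : x = 0 := by
      ext j
      simpa [φ] using (Submodule.mem_iInf _).1 hx j
    simp [this]
  rw [hspan] at hsp
  have : Finite κ := Finite.of_injective a ha
  have := Fintype.ofFinite κ
  have hκ : Fintype.card κ = k := by
    rw [← hC, ← Subspace.dual_finrank_eq]
    exact (Module.finrank_eq_card_basis (Module.Basis.mk hli hsp.ge)).symm
  let q : Fin k → Fin (k + m) := a ∘ (Fintype.equivFinOfCardEq hκ).symm
  have hq : Function.Injective q := ha.comp (Equiv.injective _)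
  obtain ⟨σ, hσ⟩ := Equiv.Perm.exists_extending_pair (Fin.castAdd m : Fin k → _) q
    (Fin.castAdd_injective k m) hq
  let T : C →ₗ[ZMod 3] (Fin k → ZMod 3) := LinearMap.pi fun i => φ (q i)
  have hT : Function.Injective T := by
    rw [← LinearMap.ker_eq_bot, eq_bot_iff]
    intro x hx
    have h0 : ∀ i : κ, φ (a i) x = 0 := fun i => by
      have := congrFun (LinearMap.mem_ker.1 hx) (Fintype.equivFinOfCardEq hκ i)
      simpa [T, q] using this
    have : ∀ f ∈ Submodule.span (ZMod 3) (Set.range (φ ∘ a)), f x = 0 := by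
      intro f hf
      induction hf using Submodule.span_induction with
      | mem f hf => obtain ⟨i, rfl⟩ := hf; exact h0 i
      | zero => rfl
      | add f g _ _ hf hg => rw [LinearMap.add_apply, hf, hg, add_zero]
      | smul c f _ hf => rw [LinearMap.smul_apply, hf, smul_zero]
    rw [Submodule.mem_bot]
    ext j
    exact this (φ j) (by rw [hsp]; trivial)
  let e := LinearEquiv.ofInjectiveOfFinrankEq T hT (by rw [hC, Module.finrank_fin_fun])
  have he : ∀ c i, e c i = (c : TernaryWord (k + m)) (q i) := fun c i => rfl
  refine ⟨Matrix.of fun i j => (e.symm (Pi.single i 1) : TernaryWord (k + m)) (σ (Fin.natAdd k j)),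
    codeEquiv_of_le σ (s := fun _ => 1) (fun _ => one_ne_zero) ?_ ?_⟩
  · intro c hc
    rw [mem_sysCode]
    intro j
    have h1 : (⟨c, hc⟩ : C) = ∑ i, c (q i) • e.symm (Pi.single i 1) := by
      apply e.injective
      ext i
      rw [he, map_sum]
      simp [Finset.sum_apply, Pi.single_apply]
    have h2 := congrArg (fun z : C => (z : TernaryWord (k + m)) (σ (Fin.natAdd k j))) h1
    have h3 : ∀ i, σ (Fin.castAdd m i) = q i := hσ
    simpa [Finset.sum_apply, h3] using h2
  · rw [hC, finrank_sysCode]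

/-- Rows and columns of the redundancy part may be permuted and rescaled. -/
lemma codeEquiv_sysCode_of_eq {A B : Matrix (Fin k) (Fin m) (ZMod 3)} (ρ : Equiv.Perm (Fin k))
    (π : Equiv.Perm (Fin m)) (r : Fin k → ZMod 3) (c : Fin m → ZMod 3) (hr : ∀ i, r i ≠ 0)
    (hc : ∀ j, c j ≠ 0) (hB : ∀ i j, B i j = r i * c j * A (ρ i) (π j)) :
    CodeEquiv (sysCode A) (sysCode B) := by
  -- Scaling row `i` by `r i` also spoils the identity block; scaling information coordinate `i` by
  -- the same `r i` repairs this, because `r i ^ 2 = 1`.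
  refine codeEquiv_of_le (finSumFinEquiv.permCongr (Equiv.sumCongr ρ π))
    (s := Fin.append r c) ?_ ?_ ?_
  · intro i
    refine Fin.addCases (fun i => ?_) (fun i => ?_) i <;> simp [hr, hc]
  · intro x hx
    rw [mem_sysCode] at hx ⊢
    intro j
    simp only [monomialMap_apply, Fin.append_left, Fin.append_right, Equiv.permCongr_apply,
      finSumFinEquiv_symm_apply_castAdd, finSumFinEquiv_symm_apply_natAdd, Equiv.sumCongr_apply,
      Sum.map_inl, Sum.map_inr, finSumFinEquiv_apply_left, finSumFinEquiv_apply_right]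
    rw [hx, Finset.mul_sum, ← Equiv.sum_comp ρ]
    refine Finset.sum_congr rfl fun i _ => ?_
    rw [hB]
    linear_combination (-(c j * x (Fin.castAdd m (ρ i)) * A (ρ i) (π j))) * mul_self_eq_one (hr i)
  · rw [finrank_sysCode, finrank_sysCode]

end Systematic

/-! ### Signed permutations given by digits -/

/-- The `i`-th of ten decimal digits. -/
def digit (N : ℕ) (i : Fin 10) : ℕ := N / 10 ^ (9 - (i : ℕ)) % 10

/-- The ten decimal digits as indices. -/
def digitIndex (N : ℕ) (i : Fin 10) : Fin 10 := ⟨digit N i, Nat.mod_lt _ (by decide)⟩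

/-- The ten decimal digits as scalars. -/
def digitScalar (N : ℕ) (i : Fin 10) : ZMod 3 := (⟨digit N i % 3, Nat.mod_lt _ (by decide)⟩ : Fin 3)

/-- The digits are those of a permutation and of a vector of signs. -/
abbrev IsSignedPerm (g : ℕ × ℕ) : Prop :=
  Function.Injective (digitIndex g.1) ∧ ∀ i, digitScalar g.2 i ≠ 0

/-- The word `x` transformed by a signed permutation. -/
def transform (g : ℕ × ℕ) (x : TernaryWord 10) : TernaryWord 10 :=
  fun i => digitScalar g.2 i * x (digitIndex g.1 i)

lemma IsSignedPerm.exists_monomialMap {g : ℕ × ℕ} (hg : IsSignedPerm g) :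
    ∃ (σ : Equiv.Perm (Fin 10)) (s : Fin 10 → ZMod 3), (∀ i, s i ≠ 0) ∧
      ∀ x, monomialMap σ s x = transform g x :=
  ⟨Equiv.ofBijective _ (Finite.injective_iff_bijective.1 hg.1), digitScalar g.2, hg.2, fun _ => rfl⟩

/-! ### Redundancy matrices, weight tests and tables of signed permutations -/

/-- The redundancy part of a generator matrix of the ternary `[10, 4, 6]` code. -/
def redundancyOvoid : Matrix (Fin 4) (Fin 6) (ZMod 3) :=
  !![0, 1, 1, 1, 1, 1; 1, 0, 1, 1, 2, 2; 1, 1, 0, 2, 1, 2; 1, 1, 2, 0, 2, 1]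

/-- The redundancy parts of the generator matrices of the codes of length `10`. -/
def redundancy : Fin 3 → Matrix (Fin 5) (Fin 5) (ZMod 3) :=
  ![!![1, 2, 2, 1, 0; 0, 1, 2, 2, 1; 1, 0, 1, 2, 2; 2, 1, 0, 1, 2; 2, 2, 1, 0, 1],
    !![0, 0, 1, 1, 1; 0, 1, 0, 1, 1; 1, 0, 1, 0, 1; 1, 1, 0, 0, 1; 1, 2, 2, 1, 0],
    !![0, 0, 1, 1, 1; 0, 1, 0, 1, 1; 1, 0, 1, 0, 1; 1, 1, 0, 0, 1; 1, 1, 1, 1, 1]]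

/-- The last two columns of the generator matrices of the codes of length `12`. -/
def tails : Fin 3 → Matrix (Fin 5) (Fin 2) (ZMod 3) :=
  ![!![1, 2; 1, 2; 1, 2; 1, 2; 1, 2], !![1, 1; 2, 2; 2, 2; 1, 1; 1, 2],
    !![1, 1; 2, 2; 2, 2; 1, 1; 0, 0]]

/-- The combination of the rows of `M` whose coefficients are the first five entries of `x`. -/
def combination {m : ℕ} (M : Matrix (Fin 5) (Fin m) (ZMod 3)) (x : TernaryWord 10) (j : Fin m) :
    ZMod 3 :=
  x 0 * M 0 j + x 1 * M 1 j + x 2 * M 2 j + x 3 * M 3 j + x 4 * M 4 j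

/-- The weight of a scalar. -/
def nz (a : ZMod 3) : ℕ := if a = 0 then 0 else 1

lemma hammingNorm_eq_sum_nz {n : ℕ} (x : TernaryWord n) : hammingNorm x = ∑ i, nz (x i) := by
  simp [hammingNorm, Finset.card_filter, nz, ite_not]

/-- The weight of a word of length `5`. -/
def weight₅ (r : Fin 5 → ZMod 3) : ℕ := nz (r 0) + nz (r 1) + nz (r 2) + nz (r 3) + nz (r 4)

/-- The weight of a word of length `6`. -/
def weight₆ (r : Fin 6 → ZMod 3) : ℕ :=
  nz (r 0) + nz (r 1) + nz (r 2) + nz (r 3) + nz (r 4) + nz (r 5)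

lemma weight₅_eq (r : Fin 5 → ZMod 3) : weight₅ r = hammingNorm r := by
  rw [hammingNorm_eq_sum_nz, Fin.sum_univ_five, weight₅]

lemma weight₆_eq (r : Fin 6 → ZMod 3) : weight₆ r = hammingNorm r := by
  rw [hammingNorm_eq_sum_nz, Fin.sum_univ_six, weight₆]

/-- Sums and differences of two rows have weight at least `4`. -/
def pairWeights₆ (r s : Fin 6 → ZMod 3) : Bool :=
  4 ≤ weight₆ (r + s) && 4 ≤ weight₆ (r - s)

/-- Sums and differences of two rows have weight at least `w`. -/
def pairWeights₅ (w : ℕ) (r s : Fin 5 → ZMod 3) : Bool :=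
  w ≤ weight₅ (r + s) && w ≤ weight₅ (r - s)

/-- Combinations of three rows with nonzero coefficients have weight at least `2`. -/
def tripleWeights (r s t : Fin 5 → ZMod 3) : Bool :=
  pairWeights₅ 2 (r + s) t && pairWeights₅ 2 (r - s) t

/-- All scalars. -/
def scalars : List (ZMod 3) := [0, 1, 2]

/-- The nonzero scalars. -/
def units : List (ZMod 3) := [1, 2]

/-- The word with the given list of entries. -/
def listWord {n : ℕ} (l : List (ZMod 3)) (i : Fin n) : ZMod 3 := l.getD i 0

/-- The rows of length `5` with first entry `1` and just one zero. -/
def normalRows₅ (i : Fin 4) : List (Fin 5 → ZMod 3) :=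
  units.flatMap fun a => units.flatMap fun b => units.map fun c =>
    listWord (![[1, 0, a, b, c], [1, a, 0, b, c], [1, a, b, 0, c], [1, a, b, c, 0]] i)

/-- The rows of length `6` with first entry `1` and just one zero, among the entries 1 to 3. -/
def normalRows₆ (i : Fin 3) : List (Fin 6 → ZMod 3) :=
  units.flatMap fun a => units.flatMap fun b => units.flatMap fun c => units.map fun d =>
    listWord (![[1, 0, a, b, c, d], [1, a, 0, b, c, d], [1, a, b, 0, c, d]] i)

lemma mem_units {a : ZMod 3} (ha : a ≠ 0) : a ∈ units := by
  revert a; decide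

lemma mem_normalRows₅ {i : Fin 4} {r : Fin 5 → ZMod 3} (h1 : r 0 = 1) (h0 : r i.succ = 0)
    (h : ∀ j, j ≠ i.succ → r j ≠ 0) : r ∈ normalRows₅ i := by
  -- `i.succAbove` skips `i`, so these are the three nonzero entries after the first, in order.
  have hu : ∀ l : Fin 3, r (i.succAbove l).succ ∈ units := fun l =>
    mem_units (h _ fun e => Fin.succAbove_ne i l (Fin.succ_injective _ e))
  simp only [normalRows₅, List.mem_flatMap, List.mem_map]
  refine ⟨_, hu 0, _, hu 1, _, hu 2, funext fun j => ?_⟩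
  fin_cases i <;> fin_cases j <;> first | exact h1.symm | exact h0.symm | rfl

lemma mem_normalRows₆ {i : Fin 3} {r : Fin 6 → ZMod 3} (h1 : r 0 = 1)
    (h0 : r (Fin.castLE (by decide) i.succ) = 0)
    (h : ∀ j, j ≠ Fin.castLE (by decide) i.succ → r j ≠ 0) : r ∈ normalRows₆ i := by
  have hu : ∀ l : Fin 4, r ((Fin.castLE (by decide) i : Fin 5).succAbove l).succ ∈ units := fun l =>
    mem_units (h _ fun e => Fin.succAbove_ne (Fin.castLE (by decide) i : Fin 5) l
      (Fin.succ_injective _ e))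
  simp only [normalRows₆, List.mem_flatMap, List.mem_map]
  refine ⟨_, hu 0, _, hu 1, _, hu 2, _, hu 3, funext fun j => ?_⟩
  fin_cases i <;> fin_cases j <;> first | exact h1.symm | exact h0.symm | rfl

/-- Signed permutations to the standard `[10, 4, 6]` code. -/
def signedPermsOvoid : List (ℕ × ℕ) :=
  [(0123456789, 1111111111), (0123456798, 1111111111), (0135729684, 1122222122),
   (0134279658, 1112211111), (0135728694, 1122222122), (0134278659, 1112211111),
   (0125639784, 1122222122), (0124369758, 1112211111), (0125638794, 1122222122),
   (0124368759, 1112211111), (0148639572, 1112222121), (0148729563, 1112222121)]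

/-- Signed permutations to the standard `[10, 5, 5]` code. -/
def signedPermsGolay : List (ℕ × ℕ) :=
  [(0146792358, 1122112222), (0146893257, 1122112222), (0136782459, 1122112222),
   (0136984257, 1122112222), (0132468795, 1122112211), (0139657824, 1122222121),
   (0126873459, 1122112222), (0126974358, 1122112222), (0123467895, 1122112211),
   (0129658734, 1122222121), (0124367985, 1122112211), (0128659743, 1122222121),
   (0132854697, 1122222112), (0142953687, 1122222112), (0143952678, 1122222112),
   (0123754698, 1122222112), (0134852679, 1122222112), (0124753689, 1122222112)]

/-- Signed permutations to each of the three codes of length `12`, preceded by the redundancy part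
of the word that extends the standard `[10, 4, 6]` code. -/
def signedPerms : Fin 3 → List (List (ZMod 3) × ℕ × ℕ) :=
  ![[([1, 2, 1, 2, 0, 1], 0182596734, 1111111112), ([1, 2, 2, 1, 1, 0], 0186492375, 1111211111)],
    [([0, 1, 0, 1, 2, 2], 0765394182, 1122111221), ([0, 1, 0, 2, 2, 1], 0834127695, 1121211122),
     ([0, 1, 1, 0, 2, 2], 0675284193, 1122111221), ([0, 1, 1, 2, 2, 0], 0695482371, 1122111122),
     ([0, 1, 2, 0, 1, 2], 0875163294, 1122211121), ([0, 1, 2, 1, 0, 2], 0621439875, 1122111122),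
     ([0, 1, 2, 2, 0, 1], 0643217895, 1121121122), ([0, 1, 2, 2, 1, 0], 0742316985, 1121121122),
     ([1, 0, 0, 1, 1, 1], 0268349157, 1121111211), ([1, 0, 0, 2, 2, 1], 1864072395, 1222211111),
     ([1, 0, 1, 0, 1, 1], 0379248156, 1121111211), ([1, 0, 1, 2, 0, 1], 0726541398, 1212121212),
     ([1, 0, 2, 0, 1, 2], 1825036794, 1221211112), ([1, 0, 2, 1, 1, 0], 0637541289, 1212121212),
     ([1, 0, 2, 2, 0, 2], 0297316458, 1121121111), ([1, 0, 2, 2, 2, 0], 0386217459, 1121121111),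
     ([1, 1, 0, 1, 0, 1], 0347189562, 1212122112), ([1, 1, 0, 1, 2, 0], 1357098462, 1212111112),
     ([1, 1, 1, 0, 0, 2], 1256089473, 1212111112), ([1, 1, 1, 0, 1, 0], 0246198573, 1212122112),
     ([1, 1, 1, 2, 0, 1], 0182579643, 1221211121), ([1, 1, 1, 2, 2, 0], 0219467583, 1222222112),
     ([1, 1, 2, 1, 0, 2], 0318476592, 1222222112), ([1, 1, 2, 1, 1, 0], 0193568742, 1221211121),
     ([1, 2, 0, 1, 1, 0], 0234685197, 1121112221), ([1, 2, 0, 2, 0, 1], 0178692435, 1112222211),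
     ([1, 2, 1, 0, 0, 1], 0324795186, 1121112221), ([1, 2, 1, 1, 0, 1], 0562738491, 1112222211),
     ([1, 2, 1, 1, 1, 0], 0573629481, 1112222211), ([1, 2, 1, 2, 0, 0], 0583926174, 1112222112),
     ([1, 2, 1, 2, 0, 2], 0231975468, 1122112121), ([1, 2, 1, 2, 1, 1], 0359842671, 1111111122),
     ([1, 2, 1, 2, 2, 1], 0215837946, 1221222212), ([1, 2, 2, 0, 1, 0], 0169783425, 1112222211),
     ([1, 2, 2, 1, 0, 0], 0592837164, 1112222112), ([1, 2, 2, 1, 1, 1], 0258943761, 1111111122),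
     ([1, 2, 2, 1, 1, 2], 0315926847, 1221222212), ([1, 2, 2, 1, 2, 0], 0321865479, 1122112121),
     ([1, 2, 2, 2, 0, 1], 0257613894, 1111121121), ([1, 2, 2, 2, 1, 0], 0356712984, 1111121121)],
    [([0, 0, 1, 2, 1, 2], 0127586349, 1212211222), ([1, 2, 0, 0, 2, 2], 0189235476, 1121221111)]]

/-- In each pair the first number spells the permutation, its leading zero being a genuine digit,
and the second spells the signs, with 2 for -1. -/
lemma isSignedPerm_ovoid : ∀ g ∈ signedPermsOvoid, IsSignedPerm g := by decide +kernel

lemma isSignedPerm_golay : ∀ g ∈ signedPermsGolay, IsSignedPerm g := by decide +kernel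

lemma isSignedPerm_signedPerms : ∀ i, ∀ P ∈ signedPerms i, IsSignedPerm P.2 := by decide +kernel

/-- The signed permutation `g` maps the code `(I | A)` to the standard `[10, 4, 6]` code. -/
def mapsToOvoid (g : ℕ × ℕ) (A : Matrix (Fin 4) (Fin 6) (ZMod 3)) : Bool :=
  (List.finRange 4).all fun l => (List.finRange 6).all fun j =>
    transform g (sysMatrix A l) (Fin.natAdd 4 j) =
      transform g (sysMatrix A l) 0 * redundancyOvoid 0 j +
      transform g (sysMatrix A l) 1 * redundancyOvoid 1 j +
      transform g (sysMatrix A l) 2 * redundancyOvoid 2 j +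
      transform g (sysMatrix A l) 3 * redundancyOvoid 3 j

/-- The signed permutation `g` maps the code `(I | A)` to the standard `[10, 5, 5]` code. -/
def mapsToGolay (g : ℕ × ℕ) (A : Matrix (Fin 5) (Fin 5) (ZMod 3)) : Bool :=
  (List.finRange 5).all fun l => (List.finRange 5).all fun j =>
    transform g (sysMatrix A l) (Fin.natAdd 5 j) =
      combination (redundancy 0) (transform g (sysMatrix A l)) j

/-- The word `(x, y)` belongs to the `i`-th code of length `12`. -/
def isCodeword (i : Fin 3) (x : TernaryWord 10) (y : TernaryWord 2) : Bool :=
  ((List.finRange 5).all fun j => x (Fin.natAdd 5 j) = combination (redundancy i) x j) &&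
    (List.finRange 2).all fun j => y j = combination (tails i) x j

/-- A signed permutation and a sign of the tail map the extension of the `[10, 4, 6]` code by the
word `(0, a, b, c, d, e, f)` to the `i`-th code of length `12`. -/
def mapsExtension (i : Fin 3) (g : ℕ × ℕ) (t a b c d e f : ZMod 3) : Bool :=
  isCodeword i (transform g (listWord [0, 0, 0, 0, a, b, c, d, e, f]))
    (listWord [t * (a * a + b * b + c * c + d * d + e * e + f * f), t]) &&
  isCodeword i (transform g (listWord [1, 0, 0, 0, 0, 1, 1, 1, 1, 1]))
    (listWord [t * (2 * (b + c + d + e + f)), 0]) &&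
  isCodeword i (transform g (listWord [0, 1, 0, 0, 1, 0, 1, 1, 2, 2]))
    (listWord [t * (2 * (a + c + d + 2 * e + 2 * f)), 0]) &&
  isCodeword i (transform g (listWord [0, 0, 1, 0, 1, 1, 0, 2, 1, 2]))
    (listWord [t * (2 * (a + b + 2 * d + e + 2 * f)), 0]) &&
  isCodeword i (transform g (listWord [0, 0, 0, 1, 1, 1, 2, 0, 2, 1]))
    (listWord [t * (2 * (a + b + 2 * c + 2 * e + f)), 0])

/-- All words of the coset of `(0, a, b, c, d, e, f)` modulo the standard `[10, 4, 6]` code have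
weight at least `4`. -/
def goodCoset (a b c d e f : ZMod 3) : Bool :=
  scalars.all fun p => scalars.all fun q => scalars.all fun r => scalars.all fun s =>
    4 ≤ nz p + nz q + nz r + nz s + nz (a + q + r + s) + nz (b + p + r + s) +
      nz (c + p + q + 2 * s) + nz (d + p + q + 2 * r) + nz (e + p + 2 * q + r + 2 * s) +
      nz (f + p + 2 * q + 2 * r + s)

/-! ### Exhaustive searches -/

/-- Rows are added one at a time and a branch is cut as soon as two rows have a sum or difference of
weight below 4 = 6 - 2. Every surviving matrix is sent to the standard code by a listed signed
permutation. -/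
lemma ovoid_search :
    ((normalRows₆ 0).all fun r => !pairWeights₆ (listWord [0, 1, 1, 1, 1, 1]) r ||
      (normalRows₆ 1).all fun s => !(pairWeights₆ (listWord [0, 1, 1, 1, 1, 1]) s &&
        pairWeights₆ r s) ||
      (normalRows₆ 2).all fun t => !(pairWeights₆ (listWord [0, 1, 1, 1, 1, 1]) t &&
        pairWeights₆ r t && pairWeights₆ s t) ||
      signedPermsOvoid.any fun g =>
        mapsToOvoid g (Matrix.of ![listWord [0, 1, 1, 1, 1, 1], r, s, t])) = true := by
  decide +kernel

/-- The first row is the one that may lack a zero, hence two starting values. Minimum weight 5 gives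
the bounds 3 = 5 - 2 for pairs and 2 = 5 - 3 for triples of rows. -/
lemma golay_search :
    ([listWord [0, 1, 1, 1, 1], listWord [1, 1, 1, 1, 1]].all fun q =>
      (normalRows₅ 0).all fun r => !pairWeights₅ 3 q r ||
      (normalRows₅ 1).all fun s => !(pairWeights₅ 3 q s && pairWeights₅ 3 r s &&
        tripleWeights q r s) ||
      (normalRows₅ 2).all fun t => !(pairWeights₅ 3 q t && pairWeights₅ 3 r t &&
        pairWeights₅ 3 s t && tripleWeights q r t && tripleWeights q s t &&
        tripleWeights r s t) ||
      (normalRows₅ 3).all fun u => !(pairWeights₅ 3 q u && pairWeights₅ 3 r u &&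
        pairWeights₅ 3 s u && pairWeights₅ 3 t u && tripleWeights q r u && tripleWeights q s u &&
        tripleWeights q t u && tripleWeights r s u && tripleWeights r t u &&
        tripleWeights s t u) ||
      signedPermsGolay.any fun g => mapsToGolay g (Matrix.of ![q, r, s, t, u])) = true := by
  decide +kernel

/-- Replacing `w` by `-w` on the `x`-part can be undone by the sign `t` on the `y`-part, so one
table entry serves both words. -/
lemma extension_search :
    (scalars.all fun a => scalars.all fun b => scalars.all fun c => scalars.all fun d =>
      scalars.all fun e => scalars.all fun f => !goodCoset a b c d e f ||
        (List.finRange 3).any fun i => (signedPerms i).any fun P => units.any fun t =>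
          P.1 == [t * a, t * b, t * c, t * d, t * e, t * f] &&
            mapsExtension i P.2 t a b c d e f) = true := by
  decide +kernel

/-- The standard `[10, 4, 6]` code has no isotropic extension. -/
lemma isotropic_search :
    (scalars.all fun a => scalars.all fun b => scalars.all fun c => scalars.all fun d =>
      scalars.all fun e => scalars.all fun f =>
        !(b + c + d + e + f == 0 && a + c + d + 2 * e + 2 * f == 0 &&
          a + b + 2 * d + e + 2 * f == 0 && a + b + 2 * c + 2 * e + f == 0 &&
          a * a + b * b + c * c + d * d + e * e + f * f == 0) ||
        (a == 0 && b == 0 && c == 0 && d == 0 && e == 0 && f == 0)) = true := by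
  decide +kernel

/-! ### Weights of combinations of rows -/

lemma hammingNorm_single_le {n : ℕ} (i : Fin n) (a : ZMod 3) :
    hammingNorm (Pi.single i a : TernaryWord n) ≤ 1 := by
  rw [hammingNorm_eq_sum_nz, Finset.sum_eq_single i]
  · unfold nz; split <;> omega
  · intro j _ hj
    simp [nz, hj]
  · simp

lemma nz_add_le : ∀ a b : ZMod 3, nz (a + b) ≤ nz a + nz b := by decide

lemma hammingNorm_add_le {n : ℕ} (x y : TernaryWord n) :
    hammingNorm (x + y) ≤ hammingNorm x + hammingNorm y := by
  simp only [hammingNorm_eq_sum_nz, ← Finset.sum_add_distrib]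
  exact Finset.sum_le_sum fun i _ => nz_add_le _ _

/-- Sums and differences of two words with the same support. -/
lemma hammingNorm_add_add_hammingNorm_sub {n : ℕ} {r s : TernaryWord n}
    (h : ∀ j, r j = 0 ↔ s j = 0) : hammingNorm (r + s) + hammingNorm (r - s) = hammingNorm r := by
  have key : ∀ a b : ZMod 3, (a = 0 ↔ b = 0) → nz (a + b) + nz (a - b) = nz a := by decide
  simp only [hammingNorm_eq_sum_nz, ← Finset.sum_add_distrib]
  exact Finset.sum_congr rfl fun j _ => key _ _ (h j)

lemma hammingNorm_le_length {n : ℕ} (x : TernaryWord n) : hammingNorm x ≤ n := by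
  simpa using hammingNorm_le_card_fintype (x := x)

section
variable {k m d : ℕ} {A : Matrix (Fin k) (Fin m) (ZMod 3)}

/-- The message `u` is encoded as `(u, uA)`, and the weight splits accordingly. -/
lemma le_weight_combination (h : ∀ c ∈ sysCode A, c ≠ 0 → d ≤ hammingNorm c)
    {u : Fin k → ZMod 3} (hu : u ≠ 0) :
    d ≤ hammingNorm u + hammingNorm (fun j => ∑ i, u i * A i j) := by
  rw [← hammingNorm_append]
  refine h _ (append_mem_sysCode A u) fun h0 => hu (funext fun i => ?_)
  simpa using congrFun h0 (Fin.castAdd m i)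

lemma le_weight_row (h : ∀ c ∈ sysCode A, c ≠ 0 → d ≤ hammingNorm c) (i : Fin k) :
    d ≤ 1 + hammingNorm (A i) := by
  have := le_weight_combination h (u := Pi.single i 1) (by simp)
  simp only [Pi.single_apply, ite_mul, one_mul, zero_mul, Finset.sum_ite_eq', Finset.mem_univ,
    if_true] at this
  exact this.trans (Nat.add_le_add_right (hammingNorm_single_le i 1) _)

lemma le_weight_rows_two (h : ∀ c ∈ sysCode A, c ≠ 0 → d ≤ hammingNorm c) {i j : Fin k}
    (hij : i ≠ j) (a : ZMod 3) : d ≤ 2 + hammingNorm (A i + a • A j) := by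
  have hu : (Pi.single i 1 + Pi.single j a : Fin k → ZMod 3) ≠ 0 := fun h0 => by
    simpa [hij] using congrFun h0 i
  have := le_weight_combination h hu
  simp only [Pi.add_apply, Pi.single_apply, add_mul, ite_mul, one_mul, zero_mul,
    Finset.sum_add_distrib, Finset.sum_ite_eq', Finset.mem_univ, if_true] at this
  refine this.trans (Nat.add_le_add_right ((hammingNorm_add_le _ _).trans ?_) _)
  exact Nat.add_le_add (hammingNorm_single_le i 1) (hammingNorm_single_le j a)

lemma le_weight_rows_three (h : ∀ c ∈ sysCode A, c ≠ 0 → d ≤ hammingNorm c) {i j l : Fin k}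
    (hij : i ≠ j) (hil : i ≠ l) (a b : ZMod 3) :
    d ≤ 3 + hammingNorm (A i + a • A j + b • A l) := by
  have hu : (Pi.single i 1 + Pi.single j a + Pi.single l b : Fin k → ZMod 3) ≠ 0 := fun h0 => by
    simpa [hij, hil] using congrFun h0 i
  have := le_weight_combination h hu
  simp only [Pi.add_apply, Pi.single_apply, add_mul, ite_mul, one_mul, zero_mul,
    Finset.sum_add_distrib, Finset.sum_ite_eq', Finset.mem_univ, if_true] at this
  refine this.trans (Nat.add_le_add_right ((hammingNorm_add_le _ _).trans ?_) _)
  exact Nat.add_le_add ((hammingNorm_add_le _ _).trans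
    (Nat.add_le_add (hammingNorm_single_le i 1) (hammingNorm_single_le j a)))
    (hammingNorm_single_le l b)

/-- Two rows do not have the same support if the minimum weight is large. -/
lemma eq_of_support_eq (h : ∀ c ∈ sysCode A, c ≠ 0 → d ≤ hammingNorm c) (hd : m + 4 < 2 * d)
    {i j : Fin k} (hs : ∀ l, A i l = 0 ↔ A j l = 0) : i = j := by
  by_contra hij
  -- On a common support, each entry vanishes in exactly one of sum and difference. Adding the two
  -- bounds gives `2d ≤ 4 + wt(A i) ≤ 4 + m`.
  have h1 := le_weight_rows_two h hij 1
  have h2 := le_weight_rows_two h hij (-1)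
  have h3 := hammingNorm_add_add_hammingNorm_sub hs
  have h4 := hammingNorm_le_length (A i)
  rw [one_smul] at h1
  rw [neg_one_smul, ← sub_eq_add_neg] at h2
  omega

/-- A word with at most one zero. -/
lemma exists_zero_index {x : TernaryWord (m + 1)} (hx : m ≤ hammingNorm x) :
    ∃ z, ∀ j, j ≠ z → x j ≠ 0 := by
  have h1 : (Finset.univ.filter fun j => x j = 0).card ≤ 1 := by
    have := Finset.card_filter_add_card_filter_not (s := Finset.univ) (fun j => x j = 0)
    simp only [Finset.card_univ, Fintype.card_fin] at this
    simp only [hammingNorm, ne_eq] at hx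
    omega
  obtain ⟨z, hz⟩ := Finset.card_le_one_iff_subset_singleton.1 h1
  refine ⟨z, fun j hj h0 => hj ?_⟩
  simpa using hz (Finset.mem_filter.2 ⟨Finset.mem_univ j, h0⟩)

/-- The normal form of a redundancy matrix: the zeros are moved to the diagonal, and the first row
and column are made to consist of ones. -/
lemma exists_normalForm (hkm : k ≤ m) {A : Matrix (Fin (k + 1)) (Fin (m + 1)) (ZMod 3)}
    (z : Fin (k + 1) → Fin (m + 1)) (hz : Function.Injective z)
    (h0 : ∀ i, i ≠ 0 → A i (z i) = 0) (h1 : ∀ i j, j ≠ z i → A i j ≠ 0) :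
    ∃ B : Matrix (Fin (k + 1)) (Fin (m + 1)) (ZMod 3), CodeEquiv (sysCode A) (sysCode B) ∧
      (∀ j, j ≠ 0 → B 0 j = 1) ∧ B 0 0 = A 0 (z 0) * A 0 (z 0) ∧ (∀ i, i ≠ 0 → B i 0 = 1) ∧
      (∀ i, i ≠ 0 → B i (Fin.castLE (by omega) i) = 0) ∧
      ∀ i j, i ≠ 0 → j ≠ Fin.castLE (by omega) i → B i j ≠ 0 := by
  obtain ⟨π, hπ⟩ := Equiv.Perm.exists_extending_pair (Fin.castLE (by omega)) z
    (Fin.castLE_injective (by omega : k + 1 ≤ m + 1)) hz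
  have hπ0 : π 0 = z 0 := hπ 0
  have hne : ∀ i j, j ≠ Fin.castLE (by omega) i → π j ≠ z i := fun i j hj e =>
    hj (π.injective (e.trans (hπ i).symm))
  -- Nonzero scalars are their own inverses, so `c` turns the nonzero entries of the first row into
  -- ones, and then `r` does the same for the first column. The value 1 is used where the first row
  -- vanishes.
  let c : Fin (m + 1) → ZMod 3 := fun j => if A 0 (π j) = 0 then 1 else A 0 (π j)
  have hc : ∀ j, c j ≠ 0 := fun j => by
    simp only [c]; split <;> simp_all
  let r : Fin (k + 1) → ZMod 3 := fun i => if i = 0 then 1 else c 0 * A i (π 0)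
  have hz0 : ∀ i, i ≠ 0 → A i (π 0) ≠ 0 := fun i hi =>
    h1 i _ fun e => hi (hz (e.symm.trans hπ0))
  have hr : ∀ i, r i ≠ 0 := fun i => by
    by_cases hi : i = 0
    · simp [r, hi]
    · simpa [r, hi] using ⟨hc 0, hz0 i hi⟩
  refine ⟨Matrix.of fun i j => r i * c j * A i (π j),
    codeEquiv_sysCode_of_eq (Equiv.refl _) π r c hr hc fun i j => rfl, ?_, ?_, ?_, ?_, ?_⟩
  · intro j hj
    have : A 0 (π j) ≠ 0 := h1 0 _ (hne 0 j hj)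
    simp [r, c, this, mul_self_eq_one]
  · simp only [Matrix.of_apply, r, c, hπ0, if_true, one_mul]
    split <;> simp_all
  · intro i hi
    have := mul_self_eq_one (mul_ne_zero (hc 0) (hz0 i hi))
    simp only [Matrix.of_apply, r, hi, if_false]
    linear_combination this
  · intro i hi
    simp [hπ i, h0 i hi]
  · intro i j _ hj
    exact mul_ne_zero (mul_ne_zero (hr i) (hc j)) (h1 i _ (hne i j hj))

end

lemma codeEquiv_sysCode_of_rows {k m : ℕ} {A B : Matrix (Fin k) (Fin m) (ZMod 3)}
    (σ : Equiv.Perm (Fin (k + m))) {s : Fin (k + m) → ZMod 3} (hs : ∀ i, s i ≠ 0)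
    (h : ∀ l, monomialMap σ s (sysMatrix A l) ∈ sysCode B) :
    CodeEquiv (sysCode A) (sysCode B) := by
  refine codeEquiv_of_le σ hs ?_ (by rw [finrank_sysCode, finrank_sysCode])
  have : sysCode A ≤ (sysCode B).comap (monomialMap σ s) := by
    unfold sysCode codeOf
    rw [Submodule.span_le]
    rintro _ ⟨l, rfl⟩
    exact h l
  exact this

/-! ### The ternary `[10, 4, 6]` code and the ternary `[10, 5, 5]` code -/

lemma codeEquiv_of_mapsToOvoid {g : ℕ × ℕ} {A : Matrix (Fin 4) (Fin 6) (ZMod 3)}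
    (hg : IsSignedPerm g) (h : mapsToOvoid g A = true) :
    CodeEquiv (sysCode A) (sysCode redundancyOvoid) := by
  obtain ⟨σ, s, hs, hσ⟩ := hg.exists_monomialMap
  refine codeEquiv_sysCode_of_rows σ hs fun l => ?_
  rw [mem_sysCode]
  intro j
  simp only [mapsToOvoid, List.all_eq_true, List.mem_finRange, forall_const,
    decide_eq_true_eq] at h
  have := h l j
  rw [← hσ] at this
  rw [this, Fin.sum_univ_four]
  rfl

lemma codeEquiv_of_mapsToGolay {g : ℕ × ℕ} {A : Matrix (Fin 5) (Fin 5) (ZMod 3)}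
    (hg : IsSignedPerm g) (h : mapsToGolay g A = true) :
    CodeEquiv (sysCode A) (sysCode (redundancy 0)) := by
  obtain ⟨σ, s, hs, hσ⟩ := hg.exists_monomialMap
  refine codeEquiv_sysCode_of_rows σ hs fun l => ?_
  rw [mem_sysCode]
  intro j
  simp only [mapsToGolay, List.all_eq_true, List.mem_finRange, forall_const,
    decide_eq_true_eq] at h
  have := h l j
  rw [← hσ] at this
  rw [this, Fin.sum_univ_five]
  rfl

lemma imp_of_not_or_eq_true {a b : Bool} (h : (!a || b) = true) (ha : a = true) : b = true := by
  simpa [ha] using h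

/-- A `[10, 4]` code all of whose nonzero weights are `6` or `9` is unique up to equivalence. -/
theorem codeEquiv_ovoid {E : TernaryCode 10} (hE : Module.finrank (ZMod 3) E = 4)
    (hw : ∀ c ∈ E, c ≠ 0 → hammingNorm c = 6 ∨ hammingNorm c = 9) :
    CodeEquiv E (sysCode redundancyOvoid) := by
  obtain ⟨A, hA⟩ := exists_codeEquiv_sysCode (k := 4) (m := 6) E hE
  have hwA := hA.forall_weight (P := fun w => w = 6 ∨ w = 9) hw
  have h6 : ∀ c ∈ sysCode A, c ≠ 0 → 6 ≤ hammingNorm c := fun c hc h0 => by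
    have := hwA c hc h0; omega
  have hrow : ∀ i, 5 ≤ hammingNorm (A i) := fun i => by
    have := le_weight_row h6 i; omega
  choose z hz using fun i => exists_zero_index (hrow i)
  have hz0 : ∀ i, A i (z i) = 0 := by
    intro i
    by_contra hne
    have hall : ∀ j, A i j ≠ 0 := fun j => by
      by_cases e : j = z i
      · rwa [e]
      · exact hz i j e
    -- A row without zeros would give a codeword of weight 7, which is neither 6 nor 9.
    have h1 : hammingNorm (A i) = 6 := by
      rw [hammingNorm, Finset.filter_true_of_mem fun j _ => hall j]; rfl
    have h2 := hwA (sysMatrix A i) (Submodule.subset_span ⟨i, rfl⟩) fun e => by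
      simpa [sysMatrix_castAdd] using congrFun e (Fin.castAdd 6 i)
    have h3 : hammingNorm (sysMatrix A i) =
        hammingNorm (Pi.single i 1 : Fin 4 → ZMod 3) + hammingNorm (A i) := hammingNorm_append _ _
    rw [h1] at h3
    have h4 := hammingNorm_single_le i 1
    have h5 : hammingNorm (Pi.single i 1 : Fin 4 → ZMod 3) ≠ 0 := by simp
    omega
  have hinj : Function.Injective z := fun i j e =>
    eq_of_support_eq h6 (by norm_num) fun l => by
      by_cases hl : l = z i
      · rw [hl, hz0, e, hz0]
      · exact iff_of_false (hz i l hl) (hz j l (e ▸ hl))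
  obtain ⟨B, hAB, hB0, hB00, hBi0, hBii, hB⟩ :=
    exists_normalForm (by norm_num) z hinj (fun i _ => hz0 i) hz
  refine (hA.trans hAB).trans ?_
  have hmin := (hA.trans hAB).forall_weight (P := fun w => 6 ≤ w) fun c hc h0 => by
    have := hw c hc h0; omega
  have hpair : ∀ i j, i ≠ j → pairWeights₆ (B i) (B j) = true := fun i j hij => by
    have h1 := le_weight_rows_two hmin hij 1
    have h2 := le_weight_rows_two hmin hij (-1)
    rw [one_smul] at h1
    rw [neg_one_smul, ← sub_eq_add_neg] at h2
    simp only [pairWeights₆, weight₆_eq, Bool.and_eq_true, decide_eq_true_eq]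
    omega
  have hq : B 0 = listWord [0, 1, 1, 1, 1, 1] := by
    rw [hz0, mul_zero] at hB00
    funext j
    fin_cases j
    · exact hB00
    all_goals exact hB0 _ (by decide)
  have hmem : ∀ i : Fin 3, B i.succ ∈ normalRows₆ i := fun i =>
    mem_normalRows₆ (hBi0 _ (Fin.succ_ne_zero i)) (hBii _ (Fin.succ_ne_zero i))
      fun j => hB _ j (Fin.succ_ne_zero i)
  have hs := ovoid_search
  rw [← hq] at hs
  have h1 := imp_of_not_or_eq_true (List.all_eq_true.1 hs _ (hmem 0)) (hpair 0 1 (by decide))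
  have h2 := imp_of_not_or_eq_true (List.all_eq_true.1 h1 _ (hmem 1)) (by
    simp only [Bool.and_eq_true]
    exact ⟨hpair _ _ (by decide), hpair _ _ (by decide)⟩)
  have h3 := imp_of_not_or_eq_true (List.all_eq_true.1 h2 _ (hmem 2)) (by
    simp only [Bool.and_eq_true]
    exact ⟨⟨hpair _ _ (by decide), hpair _ _ (by decide)⟩, hpair _ _ (by decide)⟩)
  obtain ⟨g, hg, h4⟩ := List.any_eq_true.1 h3
  have hBe : B = Matrix.of ![B 0, B (Fin.succ 0), B (Fin.succ 1), B (Fin.succ 2)] := by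
    ext i j
    fin_cases i <;> rfl
  rw [hBe]
  exact codeEquiv_of_mapsToOvoid (isSignedPerm_ovoid g hg) h4

/-- The `[10, 5, 5]` code is unique up to equivalence. -/
theorem codeEquiv_golay {D : TernaryCode 10} (hD : IsTernaryCode 10 5 5 D) :
    CodeEquiv D (sysCode (redundancy 0)) := by
  have hw : ∀ c ∈ D, c ≠ 0 → 5 ≤ hammingNorm c := fun c hc h0 => hD.2.2 ⟨c, hc, h0, rfl⟩
  obtain ⟨A, hA⟩ := exists_codeEquiv_sysCode (k := 5) (m := 5) D hD.1
  have hwA := hA.forall_weight (P := fun w => 5 ≤ w) hw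
  have hrow : ∀ i, 4 ≤ hammingNorm (A i) := fun i => by
    have := le_weight_row hwA i; omega
  choose z hz using fun i => exists_zero_index (hrow i)
  have hfull : ∀ i, A i (z i) ≠ 0 → ∀ j, A i j ≠ 0 := fun i hi j => by
    by_cases e : j = z i
    · rwa [e]
    · exact hz i j e
  have hinj : ∀ i j, A i (z i) = 0 → A j (z j) = 0 → z i = z j → i = j := fun i j hi hj e =>
    eq_of_support_eq hwA (by norm_num) fun l => by
      by_cases hl : l = z i
      · rw [hl, hi, e, hj]
      · exact iff_of_false (hz i l hl) (hz j l (e ▸ hl))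
  -- Two rows without zeros would have the same support, so at most one row `k` is exceptional.
  obtain ⟨k, hk⟩ : ∃ k, ∀ i, i ≠ k → A i (z i) = 0 := by
    by_cases h : ∃ k, A k (z k) ≠ 0
    · obtain ⟨k, hk⟩ := h
      refine ⟨k, fun i hi => ?_⟩
      by_contra hne
      exact hi (eq_of_support_eq hwA (by norm_num) fun l =>
        iff_of_false (hfull i hne l) (hfull k hk l))
    · push Not at h
      exact ⟨0, fun i _ => h i⟩
  -- The column assigned to row `k`: that of its zero if there is one, otherwise one missed by the
  -- zeros of the other four rows. Row `k` is then swapped to the top.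
  obtain ⟨y, hy, hky⟩ : ∃ y, (∀ i, i ≠ k → z i ≠ y) ∧ ∀ j, j ≠ y → A k j ≠ 0 := by
    by_cases h : A k (z k) = 0
    · exact ⟨z k, fun i hi e => hi (hinj i k (hk i hi) h e), hz k⟩
    · have hcard : ((Finset.univ.erase k).image z).card < (Finset.univ : Finset (Fin 5)).card :=
        Finset.card_image_le.trans_lt (by simp)
      obtain ⟨y, -, hy⟩ := Finset.exists_mem_notMem_of_card_lt_card hcard
      exact ⟨y, fun i hi e => hy (Finset.mem_image.2 ⟨i, by simp [hi], e⟩), fun j _ => hfull k h j⟩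
  have hA' : CodeEquiv (sysCode A) (sysCode (Matrix.of fun i j => A (Equiv.swap 0 k i) j)) :=
    codeEquiv_sysCode_of_eq (Equiv.swap 0 k) (Equiv.refl _) (fun _ => 1) (fun _ => 1)
      (fun _ => one_ne_zero) (fun _ => one_ne_zero) fun i j => by simp
  have hsw : ∀ i, i ≠ 0 → Equiv.swap 0 k i ≠ k := fun i hi e => hi <| by
    rw [← Equiv.swap_apply_left 0 k] at e
    exact (Equiv.swap 0 k).injective e
  obtain ⟨B, hAB, hB0, hB00, hBi0, hBii, hB⟩ :=
    exists_normalForm (A := Matrix.of fun i j => A (Equiv.swap 0 k i) j) (le_refl 4)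
      (fun i => if i = 0 then y else z (Equiv.swap 0 k i)) (by
        intro i j e
        by_cases hi : i = 0 <;> by_cases hj : j = 0
        · rw [hi, hj]
        · exact absurd (by simpa [hi, hj] using e.symm) (hy _ (hsw j hj))
        · exact absurd (by simpa [hi, hj] using e) (hy _ (hsw i hi))
        · refine (Equiv.swap 0 k).injective (hinj _ _ (hk _ (hsw i hi)) (hk _ (hsw j hj)) ?_)
          simpa [hi, hj] using e)
      (fun i hi => by simpa [hi] using hk _ (hsw i hi))
      (fun i j hj => by
        by_cases hi : i = 0
        · simpa [hi] using hky j (by simpa [hi] using hj)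
        · exact hz _ j (by simpa [hi] using hj))
  have hDB := (hA.trans hA').trans hAB
  refine hDB.trans ?_
  have hmin := hDB.forall_weight (P := fun w => 5 ≤ w) hw
  have hp : ∀ i j, i ≠ j → pairWeights₅ 3 (B i) (B j) = true := fun i j hij => by
    have h1 := le_weight_rows_two hmin hij 1
    have h2 := le_weight_rows_two hmin hij (-1)
    rw [one_smul] at h1
    rw [neg_one_smul, ← sub_eq_add_neg] at h2
    simp only [pairWeights₅, weight₅_eq, Bool.and_eq_true, decide_eq_true_eq]
    omega
  have ht : ∀ i j l, i ≠ j → i ≠ l → tripleWeights (B i) (B j) (B l) = true := by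
    intro i j l hij hil
    have h1 := le_weight_rows_three hmin hij hil 1 1
    have h2 := le_weight_rows_three hmin hij hil 1 (-1)
    have h3 := le_weight_rows_three hmin hij hil (-1) 1
    have h4 := le_weight_rows_three hmin hij hil (-1) (-1)
    simp only [one_smul, neg_one_smul, ← sub_eq_add_neg] at h1 h2 h3 h4
    simp only [tripleWeights, pairWeights₅, weight₅_eq, Bool.and_eq_true, decide_eq_true_eq]
    omega
  have hq : B 0 ∈ [(listWord [0, 1, 1, 1, 1] : Fin 5 → ZMod 3), listWord [1, 1, 1, 1, 1]] := by
    -- The corner entry of the normal form is a square.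
    have h01 : ∀ a : ZMod 3, a * a = 0 ∨ a * a = 1 := by decide
    have hlist : ∀ a : ZMod 3, B 0 0 = a → B 0 = listWord [a, 1, 1, 1, 1] := fun a ha => by
      funext j
      fin_cases j
      · exact ha
      all_goals exact hB0 _ (by decide)
    rw [List.mem_cons, List.mem_singleton]
    exact (h01 _).imp (fun h => hlist 0 (hB00.trans h)) fun h => hlist 1 (hB00.trans h)
  have hmem : ∀ i : Fin 4, B i.succ ∈ normalRows₅ i := fun i =>
    mem_normalRows₅ (hBi0 _ (Fin.succ_ne_zero i)) (hBii _ (Fin.succ_ne_zero i))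
      fun j => hB _ j (Fin.succ_ne_zero i)
  have h0 := List.all_eq_true.1 golay_search _ hq
  have h1 := imp_of_not_or_eq_true (List.all_eq_true.1 h0 _ (hmem 0)) (hp _ _ (by decide))
  have h2 := imp_of_not_or_eq_true (List.all_eq_true.1 h1 _ (hmem 1)) (by
    simp only [Bool.and_eq_true]
    refine ⟨⟨?_, ?_⟩, ?_⟩ <;>
      first | exact hp _ _ (by decide) | exact ht _ _ _ (by decide) (by decide))
  have h3 := imp_of_not_or_eq_true (List.all_eq_true.1 h2 _ (hmem 2)) (by
    simp only [Bool.and_eq_true, and_assoc]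
    refine ⟨?_, ?_, ?_, ?_, ?_, ?_⟩ <;>
      first | exact hp _ _ (by decide) | exact ht _ _ _ (by decide) (by decide))
  have h4 := imp_of_not_or_eq_true (List.all_eq_true.1 h3 _ (hmem 3)) (by
    simp only [Bool.and_eq_true, and_assoc]
    refine ⟨?_, ?_, ?_, ?_, ?_, ?_, ?_, ?_, ?_, ?_⟩ <;>
      first | exact hp _ _ (by decide) | exact ht _ _ _ (by decide) (by decide))
  obtain ⟨g, hg, h5⟩ := List.any_eq_true.1 h4
  have hBe : B = Matrix.of ![B 0, B (Fin.succ 0), B (Fin.succ 1), B (Fin.succ 2),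
      B (Fin.succ 3)] := by
    ext i j
    fin_cases i <;> rfl
  rw [hBe]
  exact codeEquiv_of_mapsToGolay (isSignedPerm_golay g hg) h5

/-! ### The codes of the statement -/

lemma juxtapose_one {m : ℕ} (M : Matrix (Fin 5) (Fin m) (ZMod 3)) :
    juxtapose 1 M = sysMatrix M := by
  ext i j
  refine Fin.addCases (fun j => ?_) (fun j => ?_) j
  · simp [juxtapose, sysMatrix, Matrix.one_apply, Pi.single_apply, eq_comm]
  · simp [juxtapose, sysMatrix]

lemma code10_eq (i : Fin 3) : code10 i = sysCode (redundancy i) := by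
  fin_cases i
  · exact congrArg codeOf (juxtapose_one (redundancy 0))
  · exact congrArg codeOf (juxtapose_one (redundancy 1))
  · exact congrArg codeOf (juxtapose_one (redundancy 2))

/-- The generator matrix of the `i`-th code of length `12`. -/
def gen12 (i : Fin 3) : Matrix (Fin 5) (Fin (10 + 2)) (ZMod 3) :=
  juxtapose (sysMatrix (redundancy i)) (tails i)

lemma code12_eq (i : Fin 3) : code12 i = codeOf (gen12 i) := by
  fin_cases i
  · exact congrArg (fun G => codeOf (juxtapose G (tails 0))) (juxtapose_one (redundancy 0))
  · exact congrArg (fun G => codeOf (juxtapose G (tails 1))) (juxtapose_one (redundancy 1))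
  · exact congrArg (fun G => codeOf (juxtapose G (tails 2))) (juxtapose_one (redundancy 2))

lemma xPart_gen12 (i : Fin 3) (l : Fin 5) : xPart (gen12 i l) = sysMatrix (redundancy i) l := by
  funext j
  simp [xPart, gen12, juxtapose]

lemma yPart_gen12 (i : Fin 3) (l : Fin 5) : yPart (gen12 i l) = tails i l := by
  funext j
  simp [yPart, gen12, juxtapose]

lemma append_xPart_yPart (c : TernaryWord (10 + 2)) :
    (Fin.append (xPart c) (yPart c) : TernaryWord (10 + 2)) = c := by
  funext j
  refine Fin.addCases (fun j => ?_) (fun j => ?_) j <;> simp [xPart, yPart]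

lemma word_ext {c d : TernaryWord (10 + 2)} (hx : xPart c = xPart d) (hy : yPart c = yPart d) :
    c = d := by
  rw [← append_xPart_yPart c, ← append_xPart_yPart d, hx, hy]

lemma hammingNorm_eq_xPart_add_yPart (c : TernaryWord (10 + 2)) :
    hammingNorm c = hammingNorm (xPart c) + hammingNorm (yPart c) := by
  rw [← hammingNorm_append, append_xPart_yPart]

lemma mem_sysCode_redundancy {i : Fin 3} {x : TernaryWord 10} :
    x ∈ sysCode (redundancy i) ↔ ∀ j, x (Fin.natAdd 5 j) = combination (redundancy i) x j := by
  rw [mem_sysCode (k := 5) (m := 5)]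
  refine forall_congr' fun j => ?_
  rw [Fin.sum_univ_five]
  rfl

lemma gen12_systematic (i : Fin 3) (l j : Fin 5) :
    gen12 i l (Fin.castAdd 2 (Fin.castAdd 5 j)) = if l = j then 1 else 0 := by
  rw [← sysMatrix_castAdd (redundancy i), ← xPart_gen12]
  rfl

lemma finrank_code12 (i : Fin 3) : Module.finrank (ZMod 3) (code12 i) = 5 := by
  rw [code12_eq]
  exact finrank_codeOf _ (gen12_systematic i)

lemma mem_code12 {i : Fin 3} {c : TernaryWord (10 + 2)} :
    c ∈ code12 i ↔ xPart c ∈ sysCode (redundancy i) ∧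
      ∀ j, yPart c j = combination (tails i) (xPart c) j := by
  rw [code12_eq, mem_codeOf_iff _ (gen12_systematic i), sysCode,
    mem_codeOf_iff _ (sysMatrix_castAdd (redundancy i))]
  constructor
  · intro h
    refine ⟨fun j => ?_, fun j => ?_⟩
    · simp only [← xPart_gen12]
      exact h (Fin.castAdd 2 j)
    · have := h (Fin.natAdd 10 j)
      rw [Fin.sum_univ_five] at this
      simp only [← yPart_gen12, combination]
      exact this
  · rintro ⟨hx, hy⟩ j
    refine Fin.addCases (fun j => ?_) (fun j => ?_) j
    · simp only [← xPart_gen12] at hx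
      exact hx j
    · have := hy j
      rw [Fin.sum_univ_five]
      simp only [← yPart_gen12, combination] at this
      exact this

lemma mem_code12_of_isCodeword {i : Fin 3} {c : TernaryWord (10 + 2)}
    (h : isCodeword i (xPart c) (yPart c) = true) : c ∈ code12 i := by
  simp only [isCodeword, Bool.and_eq_true, List.all_eq_true, List.mem_finRange, forall_const,
    decide_eq_true_eq] at h
  exact mem_code12.2 ⟨mem_sysCode_redundancy.2 h.1, h.2⟩

/-- The linear map behind `xPart`. -/
def xLinear : TernaryWord (10 + 2) →ₗ[ZMod 3] TernaryWord 10 :=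
  LinearMap.funLeft (ZMod 3) (ZMod 3) (Fin.castAdd 2)

lemma xLinear_apply (c : TernaryWord (10 + 2)) : xLinear c = xPart c := rfl

lemma puncture_eq (C : TernaryCode (10 + 2)) : puncture C = C.map xLinear := rfl

lemma puncture_code12 (i : Fin 3) : puncture (code12 i) = code10 i := by
  rw [puncture_eq, code12_eq, code10_eq, codeOf, sysCode, codeOf, Submodule.map_span,
    ← Set.range_comp]
  congr 2
  funext l
  exact xPart_gen12 i l

/-! ### Weights in the three codes -/

/-- The weight of the codeword of length `10` with the given first entries. -/
def codeWeight (i : Fin 3) (u : List (ZMod 3)) : ℕ :=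
  weight₅ (listWord u) + weight₅ (combination (redundancy i) (listWord u))

/-- All numerical facts about the three codes in one run over the messages: minimum weight in length
12, condition (C1), minimum weight in length 10, and the upper bound 9 that separates the second
punctured code from the third. -/
lemma weights_search :
    ((List.finRange 3).all fun i => scalars.all fun a => scalars.all fun b => scalars.all fun c =>
      scalars.all fun d => scalars.all fun e =>
        (a == 0 && b == 0 && c == 0 && d == 0 && e == 0) ||
        (6 ≤ codeWeight i [a, b, c, d, e] +
            (nz (combination (tails i) (listWord [a, b, c, d, e]) 0) +
            nz (combination (tails i) (listWord [a, b, c, d, e]) 1)) &&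
          ((codeWeight i [a, b, c, d, e] : ZMod 3) =
            combination (tails i) (listWord [a, b, c, d, e]) 0 *
            combination (tails i) (listWord [a, b, c, d, e]) 1) &&
          ((if i = 0 then 5 else 4) ≤ codeWeight i [a, b, c, d, e]) &&
          (codeWeight i [a, b, c, d, e] ≤ if i = 1 then 9 else 10))) = true := by
  decide +kernel

lemma mem_scalars (a : ZMod 3) : a ∈ scalars := by revert a; decide

lemma all_scalars {p : ZMod 3 → Bool} (h : scalars.all p = true) (a : ZMod 3) : p a = true :=
  List.all_eq_true.1 h a (mem_scalars a)

lemma weights_of_mem {i : Fin 3} {x : TernaryWord 10} (hx : x ∈ sysCode (redundancy i))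
    (h0 : x ≠ 0) :
    6 ≤ hammingNorm x + hammingNorm (combination (tails i) x) ∧
      (hammingNorm x : ZMod 3) = combination (tails i) x 0 * combination (tails i) x 1 ∧
      (if i = 0 then 5 else 4) ≤ hammingNorm x ∧ hammingNorm x ≤ if i = 1 then 9 else 10 := by
  rw [mem_sysCode_redundancy] at hx
  have hcomb : ∀ {m : ℕ} (M : Matrix (Fin 5) (Fin m) (ZMod 3)),
      combination M (listWord [x 0, x 1, x 2, x 3, x 4]) = combination M x := fun M => rfl
  have hw : codeWeight i [x 0, x 1, x 2, x 3, x 4] = hammingNorm x := by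
    have hxe : x = (Fin.append (listWord [x 0, x 1, x 2, x 3, x 4] : Fin 5 → ZMod 3)
        (combination (redundancy i) x) : Fin (5 + 5) → ZMod 3) := by
      funext j
      refine Fin.addCases (m := 5) (n := 5) (fun j => ?_) (fun j => ?_) j
      · rw [Fin.append_left]
        fin_cases j <;> rfl
      · rw [Fin.append_right]
        exact hx j
    conv_rhs => rw [hxe]
    rw [hammingNorm_append, codeWeight, weight₅_eq, weight₅_eq, hcomb]
  have h := all_scalars (all_scalars (all_scalars (all_scalars (all_scalars
    (List.all_eq_true.1 weights_search i (List.mem_finRange i)) (x 0)) (x 1)) (x 2)) (x 3)) (x 4)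
  rw [Bool.or_eq_true] at h
  rcases h with h | h
  · simp only [Bool.and_eq_true, beq_iff_eq, and_assoc] at h
    obtain ⟨e0, e1, e2, e3, e4⟩ := h
    refine absurd (funext fun j => ?_) h0
    refine Fin.addCases (m := 5) (n := 5) (fun j => ?_) (fun j => ?_) j
    · fin_cases j <;> assumption
    · rw [hx j]
      simp [combination, e0, e1, e2, e3, e4]
  · simp only [Bool.and_eq_true, decide_eq_true_eq, hw, hcomb] at h
    obtain ⟨⟨⟨h1, h2⟩, h3⟩, h4⟩ := h
    refine ⟨?_, h2, h3, h4⟩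
    rwa [hammingNorm_eq_sum_nz (combination (tails i) x), Fin.sum_univ_two]

lemma isTernaryCode_code10 (i : Fin 3) :
    IsTernaryCode 10 5 (if i = 0 then 5 else 4) (code10 i) := by
  rw [code10_eq]
  refine ⟨finrank_sysCode (redundancy i), ?_, ?_⟩
  · have h : ∃ l : Fin 5, hammingNorm (sysMatrix (redundancy i) l) = if i = 0 then 5 else 4 := by
      revert i; decide +kernel
    obtain ⟨l, hl⟩ := h
    exact ⟨_, Submodule.subset_span ⟨l, rfl⟩,
      fun h0 => by simpa [sysMatrix_castAdd] using congrFun h0 (Fin.castAdd 5 l), hl⟩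
  · rintro _ ⟨c, hc, h0, rfl⟩
    exact (weights_of_mem hc h0).2.2.1

lemma not_codeEquiv_code10 {i j : Fin 3} (hij : i < j) : ¬ CodeEquiv (code10 i) (code10 j) := by
  intro h
  rw [code10_eq, code10_eq] at h
  by_cases hi : i = 0
  · subst hi
    have hj : j ≠ 0 := hij.ne'
    obtain ⟨c, hc, h0, hw⟩ := (isTernaryCode_code10 j).2.1
    rw [code10_eq] at hc
    have := h.forall_weight (P := fun w => 5 ≤ w)
      (fun c hc h0 => (weights_of_mem hc h0).2.2.1) c hc h0
    rw [hw, if_neg hj] at this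
    omega
  · obtain ⟨rfl, rfl⟩ : i = 1 ∧ j = 2 := by omega
    -- A word of weight 10, whereas the weights of `code10 1` are at most 9.
    have h10 : (listWord [1, 1, 1, 2, 2, 2, 2, 1, 1, 1] : TernaryWord 10) ∈
        sysCode (redundancy 2) := by
      rw [mem_sysCode_redundancy]; decide +kernel
    have := h.forall_weight (P := fun w => w ≤ 9)
      (fun c hc h0 => (weights_of_mem hc h0).2.2.2) _ h10 (by decide +kernel)
    revert this
    decide +kernel

lemma isTernaryCode_code12 (i : Fin 3) : IsTernaryCode (10 + 2) 5 6 (code12 i) := by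
  refine ⟨finrank_code12 i, ?_, ?_⟩
  · have hu : hammingNorm (gen12 i 0 - gen12 i 1) = 6 := by
      revert i; decide +kernel
    refine ⟨_, ?_, ?_, hu⟩
    · rw [code12_eq]
      exact sub_mem (Submodule.subset_span ⟨0, rfl⟩) (Submodule.subset_span ⟨1, rfl⟩)
    · intro h0
      rw [h0] at hu
      simp at hu
  · rintro _ ⟨c, hc, h0, rfl⟩
    rw [mem_code12] at hc
    rw [hammingNorm_eq_xPart_add_yPart, funext hc.2]
    refine (weights_of_mem hc.1 fun hx => h0 (word_ext hx (funext fun j => ?_))).1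
    rw [hc.2, hx]
    simp [combination, yPart]

lemma szConditions_code12 (i : Fin 3) : SZConditions (code12 i) := by
  have key : ∀ c ∈ code12 i, c ≠ 0 → xPart c ≠ 0 := fun c hc h0 hx => by
    rw [mem_code12] at hc
    refine h0 (word_ext hx (funext fun j => ?_))
    rw [hc.2, hx]
    simp [combination, yPart]
  have four : ∀ c ∈ code12 i, c ≠ 0 → 4 ≤ hammingNorm (xPart c) := fun c hc h0 => by
    have := (weights_of_mem (mem_code12.1 hc).1 (key c hc h0)).2.2.1
    split at this <;> omega
  refine ⟨fun c hc => ?_, fun c hc h0 => ?_, fun c hc h3 => ?_⟩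
  · by_cases h0 : c = 0
    · subst h0
      have : xPart (0 : TernaryWord (10 + 2)) = 0 := rfl
      rw [this, hammingNorm_zero]
      simp [yPart]
    · have h := mem_code12.1 hc
      rw [h.2, h.2]
      exact (weights_of_mem h.1 (key c hc h0)).2.1
  · have := four c hc h0; omega
  · have h0 : c ≠ 0 := by
      rintro rfl
      have : xPart (0 : TernaryWord (10 + 2)) = 0 := rfl
      rw [this, hammingNorm_zero] at h3
      omega
    have := four c hc h0; omega

/-! ### SZ-equivalence -/

@[simp] lemma xPart_append (x : TernaryWord 10) (y : TernaryWord 2) :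
    xPart (Fin.append x y : TernaryWord (10 + 2)) = x := by
  funext j; simp [xPart]

@[simp] lemma yPart_append (x : TernaryWord 10) (y : TernaryWord 2) :
    yPart (Fin.append x y : TernaryWord (10 + 2)) = y := by
  funext j; simp [yPart]

lemma xPart_add (c d : TernaryWord (10 + 2)) : xPart (c + d) = xPart c + xPart d := rfl

lemma yPart_add (c d : TernaryWord (10 + 2)) : yPart (c + d) = yPart c + yPart d := rfl

lemma xPart_smul (a : ZMod 3) (c : TernaryWord (10 + 2)) : xPart (a • c) = a • xPart c := rfl

lemma yPart_smul (a : ZMod 3) (c : TernaryWord (10 + 2)) : yPart (a • c) = a • yPart c := rfl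

/-- The maps of SZ-equivalences, with arbitrary scalars. -/
def szLinear (σ : Equiv.Perm (Fin 10)) (s : Fin 10 → ZMod 3) (τ : Equiv.Perm (Fin 2)) (t : ZMod 3) :
    TernaryWord (10 + 2) →ₗ[ZMod 3] TernaryWord (10 + 2) where
  toFun c := Fin.append (monomialMap σ s (xPart c)) (fun j => t * yPart c (τ j))
  map_add' c d := by
    refine word_ext ?_ ?_
    · exact (xPart_append _ _).trans ((map_add (monomialMap σ s) (xPart c) (xPart d)).trans
        (congrArg₂ _ (xPart_append _ _).symm (xPart_append _ _).symm))
    · exact (yPart_append _ _).trans ((funext fun j => mul_add t (yPart c (τ j))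
        (yPart d (τ j))).trans (congrArg₂ (fun u v : TernaryWord 2 => u + v)
          (yPart_append _ _).symm (yPart_append _ _).symm))
  map_smul' a c := by
    refine word_ext ?_ ?_
    · exact (xPart_append _ _).trans ((map_smul (monomialMap σ s) a (xPart c)).trans
        (congrArg (a • ·) (xPart_append _ _).symm))
    · exact (yPart_append _ _).trans ((funext fun j => mul_left_comm t a (yPart c (τ j))).trans
        (congrArg (a • ·) (yPart_append _ _).symm))

section
variable {σ : Equiv.Perm (Fin 10)} {s : Fin 10 → ZMod 3} {τ : Equiv.Perm (Fin 2)} {t : ZMod 3}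

@[simp] lemma xPart_szLinear (c : TernaryWord (10 + 2)) :
    xPart (szLinear σ s τ t c) = monomialMap σ s (xPart c) :=
  xPart_append (monomialMap σ s (xPart c)) (fun j => t * yPart c (τ j))

@[simp] lemma yPart_szLinear (c : TernaryWord (10 + 2)) :
    yPart (szLinear σ s τ t c) = fun j => t * yPart c (τ j) :=
  yPart_append (monomialMap σ s (xPart c)) (fun j => t * yPart c (τ j))

lemma szLinear_injective (hs : ∀ i, s i ≠ 0) (ht : t ≠ 0) :
    Function.Injective (szLinear σ s τ t) := by
  intro c d h
  refine word_ext (monomialMap_injective σ hs ?_) (funext fun j => ?_)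
  · simpa using congrArg xPart h
  · have := congrFun (congrArg yPart h) (τ.symm j)
    simpa [ht] using this

lemma szEquiv_iff {C C' : TernaryCode (10 + 2)} :
    SZEquiv C C' ↔ ∃ (σ : Equiv.Perm (Fin 10)) (s : Fin 10 → ZMod 3) (τ : Equiv.Perm (Fin 2))
      (t : ZMod 3), (∀ i, s i ≠ 0) ∧ t ≠ 0 ∧ C.map (szLinear σ s τ t) = C' := by
  constructor
  · rintro ⟨σ, α, τ, β, h⟩
    refine ⟨σ, fun i => (-1) ^ (α i : ℕ), τ, (-1) ^ (β : ℕ), fun i => neg_one_pow_ne_zero_three _,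
      neg_one_pow_ne_zero_three _, ?_⟩
    apply SetLike.coe_injective
    rw [h]; rfl
  · rintro ⟨σ, s, τ, t, hs, ht, rfl⟩
    choose α hα using fun i => exists_sign_eq (s i) (hs i)
    obtain ⟨β, rfl⟩ := exists_sign_eq t ht
    obtain rfl : (fun i => (-1) ^ (α i : ℕ)) = s := funext hα
    exact ⟨σ, α, τ, β, rfl⟩

lemma SZEquiv.trans {C C' C'' : TernaryCode (10 + 2)} (h : SZEquiv C C') (h' : SZEquiv C' C'') :
    SZEquiv C C'' := by
  rw [szEquiv_iff] at h h' ⊢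
  obtain ⟨σ, s, τ, t, hs, ht, rfl⟩ := h
  obtain ⟨σ', s', τ', t', hs', ht', rfl⟩ := h'
  refine ⟨σ'.trans σ, fun i => s' i * s (σ' i), τ'.trans τ, t' * t,
    fun i => mul_ne_zero (hs' _) (hs _), mul_ne_zero ht' ht, ?_⟩
  rw [← Submodule.map_comp]
  congr 1
  refine LinearMap.ext fun c => word_ext ?_ ?_
  · simp [← monomialMap_comp]
  · simp [mul_assoc]

lemma szEquiv_of_le {C C' : TernaryCode (10 + 2)} (hs : ∀ i, s i ≠ 0) (ht : t ≠ 0)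
    (hle : C.map (szLinear σ s τ t) ≤ C')
    (hr : Module.finrank (ZMod 3) C = Module.finrank (ZMod 3) C') : SZEquiv C C' := by
  refine szEquiv_iff.2 ⟨σ, s, τ, t, hs, ht, Submodule.eq_of_le_of_finrank_eq hle ?_⟩
  rw [finrank_map_of_injective (szLinear_injective hs ht), hr]

lemma puncture_map_szLinear (C : TernaryCode (10 + 2)) :
    puncture (C.map (szLinear σ s τ t)) = (puncture C).map (monomialMap σ s) := by
  rw [puncture_eq, puncture_eq, ← Submodule.map_comp, ← Submodule.map_comp]
  congr 1
  exact LinearMap.ext fun c => xPart_szLinear c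

/-- This makes the punctured code an invariant, which separates the three SZ-classes. -/
lemma SZEquiv.codeEquiv_puncture {C C' : TernaryCode (10 + 2)} (h : SZEquiv C C') :
    CodeEquiv (puncture C) (puncture C') := by
  obtain ⟨σ, s, τ, t, hs, ht, rfl⟩ := szEquiv_iff.1 h
  exact codeEquiv_iff.2 ⟨σ, s, hs, (puncture_map_szLinear C).symm⟩

end

/-! ### The classification -/

/-- The properties used in the classification. -/
structure IsIsotropicCode (C : TernaryCode (10 + 2)) : Prop where
  finrank_eq : Module.finrank (ZMod 3) C = 5
  four_le : ∀ c ∈ C, c ≠ 0 → 4 ≤ hammingNorm (xPart c)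
  weight_mod : ∀ c ∈ C, (hammingNorm (xPart c) : ZMod 3) = yPart c 0 * yPart c 1

/-- Of at least six nonzero entries at most two lie in `y`. -/
lemma isIsotropicCode_of_szConditions {C : TernaryCode (10 + 2)}
    (hC : IsTernaryCode (10 + 2) 5 6 C) (h : SZConditions C) : IsIsotropicCode C := by
  refine ⟨hC.1, fun c hc h0 => ?_, h.weight_mod⟩
  have h1 : 6 ≤ hammingNorm c := hC.2.2 ⟨c, hc, h0, rfl⟩
  rw [hammingNorm_eq_xPart_add_yPart] at h1
  have := hammingNorm_le_length (yPart c)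
  omega

/-- Nonzero elements of `𝔽₃` have square 1; this turns weights into a quadratic form. -/
lemma hammingNorm_cast {n : ℕ} (x : TernaryWord n) :
    (hammingNorm x : ZMod 3) = ∑ i, x i * x i := by
  have key : ∀ a : ZMod 3, (nz a : ZMod 3) = a * a := by decide
  rw [hammingNorm_eq_sum_nz, Nat.cast_sum]
  exact Finset.sum_congr rfl fun i _ => key _

namespace IsIsotropicCode
variable {C : TernaryCode (10 + 2)}

lemma map (hC : IsIsotropicCode C) (σ : Equiv.Perm (Fin 10)) {s : Fin 10 → ZMod 3}
    (hs : ∀ i, s i ≠ 0) : IsIsotropicCode (C.map (szLinear σ s 1 1)) := by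
  refine ⟨?_, ?_, ?_⟩
  · rw [finrank_map_of_injective (szLinear_injective hs one_ne_zero), hC.finrank_eq]
  · rintro _ ⟨c, hc, rfl⟩ h0
    rw [xPart_szLinear, hammingNorm_monomialMap σ hs]
    exact hC.four_le c hc fun h => h0 (by rw [h, map_zero])
  · rintro _ ⟨c, hc, rfl⟩
    rw [xPart_szLinear, hammingNorm_monomialMap σ hs, hC.weight_mod c hc]
    simp

/-- The polarisation of the weight condition. -/
lemma sum_mul (hC : IsIsotropicCode C) {c d : TernaryWord (10 + 2)} (hc : c ∈ C) (hd : d ∈ C) :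
    2 * ∑ i, xPart c i * xPart d i = yPart c 0 * yPart d 1 + yPart c 1 * yPart d 0 := by
  have h1 := hC.weight_mod c hc
  have h2 := hC.weight_mod d hd
  have h3 := hC.weight_mod (c + d) (C.add_mem hc hd)
  have hx : ∀ i, xPart (c + d) i = xPart c i + xPart d i := fun i => rfl
  have hy : ∀ i, yPart (c + d) i = yPart c i + yPart d i := fun i => rfl
  rw [hammingNorm_cast] at h1 h2 h3
  simp only [hx, hy] at h3
  have h4 : ∑ i, (xPart c i + xPart d i) * (xPart c i + xPart d i) =
      ∑ i, xPart c i * xPart c i + ∑ i, xPart d i * xPart d i +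
        2 * ∑ i, xPart c i * xPart d i := by
    rw [Finset.mul_sum, ← Finset.sum_add_distrib, ← Finset.sum_add_distrib]
    exact Finset.sum_congr rfl fun i _ => by ring
  linear_combination h3 - h1 - h2 - h4

lemma xPart_injective (hC : IsIsotropicCode C) {c : TernaryWord (10 + 2)} (hc : c ∈ C)
    (h : xPart c = 0) : c = 0 := by
  by_contra h0
  have := hC.four_le c hc h0
  rw [h, hammingNorm_zero] at this
  omega

/-- A four-dimensional subcode on which the last coordinate vanishes. -/
lemma exists_subcode (hC : IsIsotropicCode C) : ∃ K ≤ C, Module.finrank (ZMod 3) K = 4 ∧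
    ∀ c ∈ K, yPart c 1 = 0 := by
  let ψ₀ : Module.Dual (ZMod 3) C := LinearMap.proj (Fin.natAdd 10 1) ∘ₗ C.subtype
  -- If `y₂` is zero on all of `C`, any nonzero functional serves: only a hyperplane inside the
  -- kernel of `y₂` is needed.
  obtain ⟨ψ, hψ, hker⟩ : ∃ ψ : Module.Dual (ZMod 3) C, ψ ≠ 0 ∧ ∀ c, ψ c = 0 → ψ₀ c = 0 := by
    by_cases h : ψ₀ = 0
    · have : Nontrivial C := Module.nontrivial_of_finrank_pos (R := ZMod 3) (by
        rw [hC.finrank_eq]; norm_num)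
      obtain ⟨ψ, hψ⟩ := exists_ne (0 : Module.Dual (ZMod 3) C)
      exact ⟨ψ, hψ, fun c _ => by rw [h]; rfl⟩
    · exact ⟨ψ₀, h, fun c => id⟩
  have hfr := Module.Dual.finrank_ker_add_one_of_ne_zero hψ
  rw [hC.finrank_eq] at hfr
  refine ⟨(LinearMap.ker ψ).map C.subtype, Submodule.map_subtype_le _ _, ?_, ?_⟩
  · rw [← (Submodule.equivMapOfInjective C.subtype C.injective_subtype _).finrank_eq]
    omega
  · rintro _ ⟨c, hc, rfl⟩
    exact hker c hc

/-- After an equivalence, the code contains lifts of the words of the standard `[10, 4, 6]` code. -/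
lemma exists_normalization (hC : IsIsotropicCode C) : ∃ C', SZEquiv C C' ∧ IsIsotropicCode C' ∧
    ∀ x ∈ sysCode redundancyOvoid, ∃ c ∈ C', xPart c = x ∧ yPart c 1 = 0 := by
  obtain ⟨K, hKC, hK, hy⟩ := hC.exists_subcode
  have hinj : Function.Injective (xLinear ∘ₗ K.subtype) := by
    rw [← LinearMap.ker_eq_bot, eq_bot_iff]
    intro c hc
    exact Subtype.ext (hC.xPart_injective (hKC c.2) hc)
  have hfr : Module.finrank (ZMod 3) (K.map xLinear) = 4 := by
    rw [← hK, ← LinearMap.finrank_range_of_inj hinj, LinearMap.range_comp, Submodule.range_subtype]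
  obtain ⟨σ, s, hs, hE⟩ := codeEquiv_iff.1 (codeEquiv_ovoid hfr (by
    rintro _ ⟨c, hc, rfl⟩ h0
    rw [xLinear_apply] at h0 ⊢
    have h1 := hC.four_le c (hKC hc) fun h => h0 (by rw [h]; rfl)
    have h2 := hC.weight_mod c (hKC hc)
    -- With `y₂ = 0` the weight is a multiple of 3 between 4 and 10.
    rw [hy c hc, mul_zero, ZMod.natCast_eq_zero_iff] at h2
    have h3 := hammingNorm_le_length (xPart c)
    omega))
  refine ⟨C.map (szLinear σ s 1 1), szEquiv_iff.2 ⟨σ, s, 1, 1, hs, one_ne_zero, rfl⟩,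
    hC.map σ hs, ?_⟩
  intro x hx
  change x ∈ (sysCode redundancyOvoid : TernaryCode 10) at hx
  rw [← hE] at hx
  obtain ⟨_, ⟨c, hc, rfl⟩, rfl⟩ := hx
  exact ⟨_, Submodule.mem_map_of_mem (hKC hc), xPart_szLinear c, by simp [hy c hc]⟩

end IsIsotropicCode

lemma sum_listWord_mul (a₀ a₁ a₂ a₃ a₄ a₅ a₆ a₇ a₈ a₉ b₀ b₁ b₂ b₃ b₄ b₅ b₆ b₇ b₈ b₉ : ZMod 3) :
    ∑ i : Fin 10, listWord [a₀, a₁, a₂, a₃, a₄, a₅, a₆, a₇, a₈, a₉] i *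
      listWord [b₀, b₁, b₂, b₃, b₄, b₅, b₆, b₇, b₈, b₉] i =
    a₀ * b₀ + a₁ * b₁ + a₂ * b₂ + a₃ * b₃ + a₄ * b₄ + a₅ * b₅ + a₆ * b₆ + a₇ * b₇ + a₈ * b₈ +
      a₉ * b₉ := by
  simp [Fin.sum_univ_succ, listWord]
  ring

/-- The rows of the generator matrix of the standard `[10, 4, 6]` code. -/
lemma sysMatrix_redundancyOvoid :
    (sysMatrix redundancyOvoid 0 : TernaryWord 10) = listWord [1, 0, 0, 0, 0, 1, 1, 1, 1, 1] ∧
    (sysMatrix redundancyOvoid 1 : TernaryWord 10) = listWord [0, 1, 0, 0, 1, 0, 1, 1, 2, 2] ∧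
    (sysMatrix redundancyOvoid 2 : TernaryWord 10) = listWord [0, 0, 1, 0, 1, 1, 0, 2, 1, 2] ∧
    (sysMatrix redundancyOvoid 3 : TernaryWord 10) = listWord [0, 0, 0, 1, 1, 1, 2, 0, 2, 1] := by
  decide +kernel

lemma eq_listWord {x : TernaryWord 10} (h : ∀ l : Fin 4, x (Fin.castAdd 6 l) = 0) :
    x = listWord [0, 0, 0, 0, x 4, x 5, x 6, x 7, x 8, x 9] := by
  funext j
  fin_cases j
  exacts [h 0, h 1, h 2, h 3, rfl, rfl, rfl, rfl, rfl, rfl]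

/-- The standard `[10, 4, 6]` code has no isotropic extension. -/
lemma eq_zero_of_isotropic {x : TernaryWord 10} (h : ∀ l : Fin 4, x (Fin.castAdd 6 l) = 0)
    (ho : ∀ l : Fin 4, ∑ i, sysMatrix redundancyOvoid l i * x i = 0) (hx : ∑ i, x i * x i = 0) :
    x = 0 := by
  have hxe := eq_listWord h
  obtain ⟨r0, r1, r2, r3⟩ := sysMatrix_redundancyOvoid
  have h0 := ho 0
  have h1 := ho 1
  have h2 := ho 2
  have h3 := ho 3
  rw [hxe, r0, sum_listWord_mul] at h0
  rw [hxe, r1, sum_listWord_mul] at h1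
  rw [hxe, r2, sum_listWord_mul] at h2
  rw [hxe, r3, sum_listWord_mul] at h3
  rw [hxe, sum_listWord_mul] at hx
  simp only [mul_zero, one_mul, zero_mul, zero_add, add_zero] at h0 h1 h2 h3 hx
  have hs := imp_of_not_or_eq_true (all_scalars (all_scalars (all_scalars (all_scalars (all_scalars
    (all_scalars isotropic_search (x 4)) (x 5)) (x 6)) (x 7)) (x 8)) (x 9))
    (by simp only [Bool.and_eq_true, beq_iff_eq]; exact ⟨⟨⟨⟨h0, h1⟩, h2⟩, h3⟩, hx⟩)
  simp only [Bool.and_eq_true, beq_iff_eq, and_assoc] at hs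
  obtain ⟨e4, e5, e6, e7, e8, e9⟩ := hs
  rw [hxe, e4, e5, e6, e7, e8, e9]
  decide +kernel

lemma mem_code12_of_transform {i : Fin 3} {g : ℕ × ℕ} {σ : Equiv.Perm (Fin 10)}
    {s : Fin 10 → ZMod 3} {t : ZMod 3} (hσ : ∀ x, monomialMap σ s x = transform g x)
    {v : TernaryWord (10 + 2)}
    (h : isCodeword i (transform g (xPart v)) (listWord [t * yPart v 0, t * yPart v 1]) = true) :
    szLinear σ s 1 t v ∈ code12 i := by
  apply mem_code12_of_isCodeword
  have hy : (listWord [t * yPart v 0, t * yPart v 1] : TernaryWord 2) =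
      fun j => t * yPart v ((1 : Equiv.Perm (Fin 2)) j) := by
    funext j
    fin_cases j <;> rfl
  rwa [xPart_szLinear, yPart_szLinear, hσ, ← hy]

namespace IsIsotropicCode
variable {C : TernaryCode (10 + 2)}

/-- A code containing lifts of the standard `[10, 4, 6]` code is spanned by lifts of its basis and
one further word, which vanishes at the first four places and ends in `1`. -/
lemma exists_generators (hC : IsIsotropicCode C)
    (hO : ∀ x ∈ sysCode redundancyOvoid, ∃ c ∈ C, xPart c = x ∧ yPart c 1 = 0) :
    ∃ (e : Fin 4 → TernaryWord (10 + 2)) (w : TernaryWord (10 + 2)),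
      (∀ l, e l ∈ C ∧ xPart (e l) = sysMatrix redundancyOvoid l ∧ yPart (e l) 1 = 0) ∧
      w ∈ C ∧ (∀ l : Fin 4, xPart w (Fin.castAdd 6 l) = 0) ∧ yPart w 1 = 1 ∧
      C ≤ Submodule.span (ZMod 3) (Set.range (Fin.cons w e : Fin 5 → TernaryWord (10 + 2))) := by
  choose e heC hex hey using fun l : Fin 4 =>
    hO (sysMatrix redundancyOvoid l) (Submodule.subset_span ⟨l, rfl⟩)
  obtain ⟨c, hc, hcO⟩ : ∃ c ∈ C, xPart c ∉ sysCode redundancyOvoid := by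
    by_contra! h
    have h1 : C.map xLinear ≤ sysCode redundancyOvoid := by
      rintro _ ⟨c, hc, rfl⟩
      exact h c hc
    have h2 := Submodule.finrank_mono h1
    have hinj : Function.Injective (xLinear ∘ₗ C.subtype) := by
      rw [← LinearMap.ker_eq_bot, eq_bot_iff]
      intro c hc
      exact Subtype.ext (hC.xPart_injective c.2 hc)
    have hfr : Module.finrank (ZMod 3) (C.map xLinear) = 5 := by
      rw [← hC.finrank_eq, ← LinearMap.finrank_range_of_inj hinj, LinearMap.range_comp,
        Submodule.range_subtype]
    rw [hfr, finrank_sysCode redundancyOvoid] at h2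
    omega
  let w : TernaryWord (10 + 2) := c - ∑ l, xPart c (Fin.castAdd 6 l) • e l
  have hw : w ∈ C := C.sub_mem hc (C.sum_mem fun l _ => C.smul_mem _ (heC l))
  have hxw : xPart w = xPart c - ∑ l, xPart c (Fin.castAdd 6 l) • sysMatrix redundancyOvoid l := by
    change xLinear w = _
    simp only [w, map_sub, map_sum, map_smul, xLinear_apply, hex]
  have hw0 : ∀ l : Fin 4, xPart w (Fin.castAdd 6 l) = 0 := fun l => by
    have h : ∀ i, sysMatrix redundancyOvoid i (Fin.castAdd 6 l) = if i = l then 1 else 0 :=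
      fun i => sysMatrix_castAdd redundancyOvoid i l
    rw [hxw, Pi.sub_apply, Finset.sum_apply]
    simp only [Pi.smul_apply, h]
    simp
  have hwne : xPart w ≠ 0 := fun h => hcO <| by
    rw [hxw, sub_eq_zero] at h
    rw [h]
    exact Submodule.sum_mem _ fun l _ => Submodule.smul_mem _ _ (Submodule.subset_span ⟨l, rfl⟩)
  -- Otherwise `xPart w` would be isotropic and orthogonal to the `[10, 4, 6]` code without lying in
  -- it.
  have hb : yPart w 1 ≠ 0 := by
    intro hb
    refine hwne (eq_zero_of_isotropic hw0 (fun l => ?_) ?_)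
    · have h := hC.sum_mul (heC l) hw
      rw [hb, hey, hex, mul_zero, zero_mul, add_zero] at h
      exact (mul_eq_zero.1 h).resolve_left (by decide)
    · rw [← hammingNorm_cast, hC.weight_mod w hw, hb, mul_zero]
  have hb1 := mul_self_eq_one hb
  refine ⟨e, yPart w 1 • w, fun l => ⟨heC l, hex l, hey l⟩, C.smul_mem _ hw, fun l => ?_, hb1, ?_⟩
  · rw [xPart_smul, Pi.smul_apply, hw0, smul_zero]
  · have hli : LinearIndependent (ZMod 3)
        (Fin.cons (yPart w 1 • w) e : Fin 5 → TernaryWord (10 + 2)) := by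
      rw [Fintype.linearIndependent_iff]
      intro u hu
      rw [Fin.sum_univ_succ] at hu
      simp only [Fin.cons_zero, Fin.cons_succ] at hu
      -- The last coordinate, of index 11, vanishes on every `e l` and is 1 on the scaled `w`.
      have hu0 : u 0 = 0 := by
        have h := congrFun hu (Fin.natAdd 10 1)
        have h1 : ∀ l, e l 11 = 0 := hey
        have h2 : yPart w 1 * w 11 = 1 := hb1
        simpa [Finset.sum_apply, h1, h2] using h
      intro l
      refine Fin.cases hu0 (fun l => ?_) l
      have h := congrFun hu (Fin.castAdd 2 (Fin.castAdd 6 l))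
      have h1 : ∀ i, e i (Fin.castAdd 2 (Fin.castAdd 6 l)) = if i = l then 1 else 0 := fun i => by
        rw [← sysMatrix_castAdd redundancyOvoid, ← hex]
        rfl
      simpa [Finset.sum_apply, h1, hu0] using h
    refine (Submodule.eq_of_le_of_finrank_eq (Submodule.span_le.2 ?_) ?_).ge
    · rintro _ ⟨l, rfl⟩
      refine Fin.cases ?_ (fun l => ?_) l
      · exact C.smul_mem _ hw
      · exact heC l
    · rw [finrank_span_eq_card hli, hC.finrank_eq, Fintype.card_fin]

theorem exists_szEquiv_code12 (hC : IsIsotropicCode C) : ∃ i, SZEquiv C (code12 i) := by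
  obtain ⟨C', hCC', hC', hO⟩ := hC.exists_normalization
  obtain ⟨e, w, he, hw, hw0, hw1, hspan⟩ := hC'.exists_generators hO
  have hxw := eq_listWord hw0
  generalize xPart w 4 = a, xPart w 5 = b, xPart w 6 = c, xPart w 7 = d, xPart w 8 = f,
    xPart w 9 = g at hxw
  obtain ⟨hx0, hx1, hx2, hx3⟩ := sysMatrix_redundancyOvoid
  rw [← (he 0).2.1] at hx0
  rw [← (he 1).2.1] at hx1
  rw [← (he 2).2.1] at hx2
  rw [← (he 3).2.1] at hx3
  have hgood : goodCoset a b c d f g = true := by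
    simp only [goodCoset, List.all_eq_true, decide_eq_true_eq]
    intro p _ q _ r _ s _
    have hmem : w + (p • e 0 + q • e 1 + r • e 2 + s • e 3) ∈ C' :=
      C'.add_mem hw (C'.add_mem (C'.add_mem (C'.add_mem (C'.smul_mem _ (he 0).1)
        (C'.smul_mem _ (he 1).1)) (C'.smul_mem _ (he 2).1)) (C'.smul_mem _ (he 3).1))
    have hy : yPart (w + (p • e 0 + q • e 1 + r • e 2 + s • e 3)) 1 = 1 := by
      simp only [yPart_add, yPart_smul, Pi.add_apply, Pi.smul_apply, (he _).2.2, hw1]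
      simp
    -- Every word of the coset of `w` has `y₂ = 1`, so it is nonzero and the weight bound applies to
    -- it.
    have h4 := hC'.four_le _ hmem fun h0 => by
      rw [h0] at hy
      exact zero_ne_one hy
    have hx : xPart (w + (p • e 0 + q • e 1 + r • e 2 + s • e 3)) =
        listWord [p, q, r, s, a + q + r + s, b + p + r + s, c + p + q + 2 * s, d + p + q + 2 * r,
          f + p + 2 * q + r + 2 * s, g + p + 2 * q + 2 * r + s] := by
      simp only [xPart_add, xPart_smul, hxw, hx0, hx1, hx2, hx3]
      funext j
      fin_cases j <;> simp [listWord] <;> ring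
    rw [hx, hammingNorm_eq_sum_nz] at h4
    simpa [Fin.sum_univ_succ, listWord, add_assoc] using h4
  -- Since `y₂` is 1 on `w` and 0 on each `e l`, the form and its polarisation express all values of
  -- `y₁` through the `x`-parts.
  have hyw : yPart w 0 = a * a + b * b + c * c + d * d + f * f + g * g := by
    have h := hC'.weight_mod w hw
    rw [hammingNorm_cast, hxw, hw1, mul_one, sum_listWord_mul] at h
    rw [← h]
    ring
  have hye : ∀ l, yPart (e l) 0 = 2 * ∑ i, xPart (e l) i * xPart w i := fun l => by
    have h := hC'.sum_mul (he l).1 hw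
    rw [hw1, (he l).2.2, zero_mul, add_zero, mul_one] at h
    exact h.symm
  have hs := imp_of_not_or_eq_true (all_scalars (all_scalars (all_scalars (all_scalars (all_scalars
    (all_scalars extension_search a) b) c) d) f) g) hgood
  simp only [List.any_eq_true] at hs
  obtain ⟨i, -, P, hP, t, ht, hs⟩ := hs
  have ht0 : t ≠ 0 := by
    have : ∀ t ∈ units, t ≠ 0 := by decide
    exact this t ht
  obtain ⟨σ, s, hσs, hσ⟩ := (isSignedPerm_signedPerms i P hP).exists_monomialMap
  simp only [mapsExtension, Bool.and_eq_true] at hs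
  obtain ⟨-, ⟨⟨⟨hsw, hs0⟩, hs1⟩, hs2⟩, hs3⟩ := hs
  have hy0 : yPart (e 0) 0 = 2 * (b + c + d + f + g) := by
    rw [hye, hx0, hxw, sum_listWord_mul]; ring
  have hy1 : yPart (e 1) 0 = 2 * (a + c + d + 2 * f + 2 * g) := by
    rw [hye, hx1, hxw, sum_listWord_mul]; ring
  have hy2 : yPart (e 2) 0 = 2 * (a + b + 2 * d + f + 2 * g) := by
    rw [hye, hx2, hxw, sum_listWord_mul]; ring
  have hy3 : yPart (e 3) 0 = 2 * (a + b + 2 * c + 2 * f + g) := by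
    rw [hye, hx3, hxw, sum_listWord_mul]; ring
  refine ⟨i, hCC'.trans (szEquiv_of_le (σ := σ) (τ := 1) hσs ht0 ?_ ?_)⟩
  · rw [Submodule.map_le_iff_le_comap]
    refine hspan.trans (Submodule.span_le.2 ?_)
    rintro _ ⟨l, rfl⟩
    refine mem_code12_of_transform hσ ?_
    fin_cases l
    · change isCodeword i (transform P.2 (xPart w)) (listWord [t * yPart w 0, t * yPart w 1]) = true
      rwa [hyw, hw1, hxw, mul_one]
    · change isCodeword i (transform P.2 (xPart (e 0)))
        (listWord [t * yPart (e 0) 0, t * yPart (e 0) 1]) = true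
      rwa [hx0, hy0, (he 0).2.2, mul_zero]
    · change isCodeword i (transform P.2 (xPart (e 1)))
        (listWord [t * yPart (e 1) 0, t * yPart (e 1) 1]) = true
      rwa [hx1, hy1, (he 1).2.2, mul_zero]
    · change isCodeword i (transform P.2 (xPart (e 2)))
        (listWord [t * yPart (e 2) 0, t * yPart (e 2) 1]) = true
      rwa [hx2, hy2, (he 2).2.2, mul_zero]
    · change isCodeword i (transform P.2 (xPart (e 3)))
        (listWord [t * yPart (e 3) 0, t * yPart (e 3) 1]) = true
      rwa [hx3, hy3, (he 3).2.2, mul_zero]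
  · rw [hC'.finrank_eq, finrank_code12]

end IsIsotropicCode

/-! ### The main theorem -/

lemma eq_of_codeEquiv_code10 {i j : Fin 3} (h : CodeEquiv (code10 i) (code10 j)) : i = j := by
  rcases lt_trichotomy i j with hij | hij | hij
  · exact absurd h (not_codeEquiv_code10 hij)
  · exact hij
  · exact absurd h.symm (not_codeEquiv_code10 hij)

theorem mainTheorem3 :
    -- the length 10 codes: the unique `[10, 5, 5]` code and two inequivalent `[10, 5, 4]` codes
    IsTernaryCode 10 5 5 (code10 0) ∧
    (∀ D : TernaryCode 10, IsTernaryCode 10 5 5 D → CodeEquiv D (code10 0)) ∧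
    IsTernaryCode 10 5 4 (code10 1) ∧
    IsTernaryCode 10 5 4 (code10 2) ∧
    ¬ CodeEquiv (code10 1) (code10 2) ∧
    -- the three length 12 codes are `[12, 5, 6]` codes with the required properties
    (∀ i : Fin 3, IsTernaryCode (10 + 2) 5 6 (code12 i) ∧ SZConditions (code12 i)) ∧
    -- they are pairwise SZ-inequivalent
    (∀ i j : Fin 3, i ≠ j → ¬ SZEquiv (code12 i) (code12 j)) ∧
    -- every such code is SZ-equivalent to one of them
    (∀ C : TernaryCode (10 + 2), IsTernaryCode (10 + 2) 5 6 C → SZConditions C →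
      ∃ i : Fin 3, SZEquiv C (code12 i)) ∧
    -- they arise from the three length 10 codes, one class from each
    (∀ i : Fin 3, puncture (code12 i) = code10 i) ∧
    (∀ C : TernaryCode (10 + 2), IsTernaryCode (10 + 2) 5 6 C → SZConditions C →
      ∀ i : Fin 3, SZEquiv C (code12 i) ↔ CodeEquiv (puncture C) (code10 i)) := by
  refine ⟨isTernaryCode_code10 0, fun D hD => ?_, isTernaryCode_code10 1, isTernaryCode_code10 2,
    not_codeEquiv_code10 (by decide), fun i => ⟨isTernaryCode_code12 i, szConditions_code12 i⟩,
    fun i j hij h => hij (eq_of_codeEquiv_code10 ?_), fun C hC hS =>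
      (isIsotropicCode_of_szConditions hC hS).exists_szEquiv_code12, puncture_code12,
    fun C hC hS i => ⟨fun h => ?_, fun h => ?_⟩⟩
  · rw [code10_eq]
    exact codeEquiv_golay hD
  · rw [← puncture_code12 i, ← puncture_code12 j]
    exact h.codeEquiv_puncture
  · rw [← puncture_code12 i]
    exact h.codeEquiv_puncture
  -- `C` lies in some class `j`; its punctured code is then equivalent to both `code10 j` and
  -- `code10 i`, which forces `j = i`.
  · obtain ⟨j, hj⟩ := (isIsotropicCode_of_szConditions hC hS).exists_szEquiv_code12
    have hij := hj.codeEquiv_puncture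
    rw [puncture_code12] at hij
    rwa [← eq_of_codeEquiv_code10 (hij.symm.trans h)]
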